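/- **Setting.** Let $H$ and $U$ be separable real Hilbert spaces, $A:D(A)\subset H\to H$ the infinitesimal generator of a $C_0$-semigroup $(S(t))_{t\ge 0}$ on $H$, $Q^{1/2}:U\to H$ a Hilbert–Schmidt operator, $u_0\in H$ deterministic, and $W_t=\sum_k f_kB^k_t$ a cylindrical Wiener process on $U$, where $(f_k)$ is a (countable) orthonormal basis of $U$ and the $B^k$ are independent standard Brownian motions on a filtered probability space $(\Omega,\mathcal F,(\mathcal F_t)_{t\ge0},\mathbb P)$. Consider the linear SPDE $du=Au\,dt+Q^{1/2}\,dW$, $u(0)=u_0$, with mild solution $$u(t)=S(t)u_0+\int_0^tS(t-s)Q^{1/2}\,dW_s ,$$ the stochastic integral being the Itô integral in $L^2(\Omega;H)$. For fixed $t>0$ put $W(h)=\int_0^t\langle h(s),dW_s\rangle_U$ for $h\in L^2([0,t];U)$. The Malliavin derivative of a smooth cylindrical functional $F=\sum_j g_j(W(h_1),\dots,W(h_n))\,v_j$, with $v_j\in H$ and $g_j$ smooth and of polynomial growth together with all derivatives, is $D_rF=\sum_{j}\sum_i\partial_ig_j(W(h_1),\dots,W(h_n))\,\langle h_i(r),\cdot\rangle_U\,v_j$;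 $D$ is extended by closure, in $L^2(\Omega;H)\times L^2(\Omega\times[0,t];\mathcal L_{\mathrm{HS}}(U,H))$, to the space $\mathbb D^{1,2}(H)$. The Malliavin covariance operator of $F\in\mathbb D^{1,2}(H)$ is $\gamma_F=\int_0^tD_rF\,(D_rF)^*\,dr$. **Theorem.** The mild solution $u$ exists. For every $t>0$, $u(t)\in\mathbb D^{1,2}(H)$, and its Malliavin covariance operator is, almost surely, $$\gamma_{u(t)}=\int_0^tS(s)\,Q^{1/2}(Q^{1/2})^*\,S(s)^*\,ds ,$$ a Bochner integral in $\mathcal L(H)$. This operator is positive, self-adjoint and trace-class. If $A$ also generates a $C_0$-group on $H$, then this group extends $S$ (write $S(t)$, $t\in\mathbb R$, for it), each $S(t)$, $t\in\mathbb R$, is invertible with inverse $S(-t)$, and with $Y_t=S(t)$, $Y_r^{-1}=S(-r)$, $$\gamma_{u(t)}=Y_tC_tY_t^*,\qquad C_t=\int_0^tY_r^{-1}Q^{1/2}(Q^{1/2})^*(Y_r^{-1})^*\,dr ,$$ where $C_t$ (again a Bochner integral in $\mathcal L(H)$) is a trace-class operator on $H$. -/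

import Mathlib

open MeasureTheory ProbabilityTheory Filter Topology Set
open scoped ENNReal NNReal

/-! ### Strongly continuous semigroups and groups, and their generators -/

/-- `(S t)_{t ≥ 0}` is a strongly continuous semigroup on `H`. The values of `S` at negative
times are irrelevant. -/
structure IsC0Semigroup {H : Type*} [NormedAddCommGroup H] [NormedSpace ℝ H]
    (S : ℝ → H →L[ℝ] H) : Prop where
  map_zero : S 0 = ContinuousLinearMap.id ℝ H
  map_add : ∀ s t : ℝ, 0 ≤ s → 0 ≤ t → S (s + t) = S s ∘L S t
  continuousOn : ∀ x : H, ContinuousOn (fun t => S t x) (Ici 0)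

/-- `A` is the infinitesimal generator of the semigroup `(S t)_{t ≥ 0}`: `x ∈ D(A)` and `A x = y`
if and only if `(S h x - x) / h → y` as `h ↓ 0`. -/
def IsGenerator {H : Type*} [NormedAddCommGroup H] [NormedSpace ℝ H]
    (A : H →ₗ.[ℝ] H) (S : ℝ → H →L[ℝ] H) : Prop :=
  ∀ x y : H, (x, y) ∈ A.graph ↔
    Tendsto (fun h : ℝ => h⁻¹ • (S h x - x)) (𝓝[>] 0) (𝓝 y)

/-- `(T t)_{t ∈ ℝ}` is a strongly continuous group on `H`. -/
structure IsC0Group {H : Type*} [NormedAddCommGroup H] [NormedSpace ℝ H]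
    (T : ℝ → H →L[ℝ] H) : Prop where
  map_zero : T 0 = ContinuousLinearMap.id ℝ H
  map_add : ∀ s t : ℝ, T (s + t) = T s ∘L T t
  continuous : ∀ x : H, Continuous (fun t => T t x)

/-- `A` is the infinitesimal generator of the group `(T t)_{t ∈ ℝ}`: `x ∈ D(A)` and `A x = y`
if and only if `(T h x - x) / h → y` as `h → 0`, `h ≠ 0`. -/
def IsGroupGenerator {H : Type*} [NormedAddCommGroup H] [NormedSpace ℝ H]
    (A : H →ₗ.[ℝ] H) (T : ℝ → H →L[ℝ] H) : Prop :=
  ∀ x y : H, (x, y) ∈ A.graph ↔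
    Tendsto (fun h : ℝ => h⁻¹ • (T h x - x)) (𝓝[≠] 0) (𝓝 y)

/-! ### Hilbert–Schmidt and trace-class operators -/

/-- The squared Hilbert–Schmidt norm `∑ k, ‖L f_k‖²`, computed in the orthonormal basis `f`, with
value `∞` if `L` is not Hilbert–Schmidt. -/
noncomputable def hsNormSq {ι U E : Type*} [NormedAddCommGroup U] [InnerProductSpace ℝ U]
    [NormedAddCommGroup E] [NormedSpace ℝ E]
    (f : HilbertBasis ι ℝ U) (L : U →L[ℝ] E) : ℝ≥0∞ :=
  ∑' k, ‖L (f k)‖ₑ ^ 2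

/-- A bounded operator on a Hilbert space is trace-class (nuclear) if
`L x = ∑ n, ⟪a n, x⟫ b n` for some vectors with `∑ n, ‖a n‖ ‖b n‖ < ∞`. -/
def IsTraceClass {H : Type*} [NormedAddCommGroup H] [InnerProductSpace ℝ H]
    (L : H →L[ℝ] H) : Prop :=
  ∃ a b : ℕ → H, Summable (fun n => ‖a n‖ * ‖b n‖) ∧
    ∀ x : H, HasSum (fun n => inner ℝ (a n) x • b n) (L x)

/-! ### Cylindrical Wiener processes and the stochastic integral of deterministic integrands -/

/-- The `B k` are independent standard Brownian motions relative to the filtration `ℱ`. With an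
orthonormal basis `(f k)` of `U` they represent the cylindrical Wiener process
`W_t = ∑ k, B_t^k f_k` on `U`. -/
structure IsCylindricalWiener {Ω ι : Type*} {mΩ : MeasurableSpace Ω} (P : Measure Ω)
    (ℱ : Filtration ℝ≥0 mΩ) (B : ι → ℝ≥0 → Ω → ℝ) : Prop where
  brownian : ∀ k, IsBrownianReal (B k) P
  indep : iIndepFun (fun k ω s => B k s ω) P
  adapted : ∀ k s, Measurable[ℱ s] (B k s)
  indep_increments : ∀ s t : ℝ≥0, s ≤ t →
    Indep (MeasurableSpace.comap (fun ω k => B k t ω - B k s ω) inferInstance) (ℱ s) P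

/-- The data of a deterministic elementary integrand on `[0, t]`: the step function
`s ↦ ∑ i, 1_{(a i, b i]}(s) ⟪f_{k i}, ·⟫ x i` with values in the operators from `U` to `E`. -/
structure ElemIntegrand (ι E : Type*) (t : ℝ≥0) where
  n : ℕ
  a : Fin n → ℝ≥0
  b : Fin n → ℝ≥0
  a_le_b : ∀ i, a i ≤ b i
  b_le : ∀ i, b i ≤ t
  k : Fin n → ι
  x : Fin n → E

/-- The operator-valued step function given by the data. -/
noncomputable def ElemIntegrand.toFun {ι U E : Type*} [NormedAddCommGroup U]
    [InnerProductSpace ℝ U] [NormedAddCommGroup E] [NormedSpace ℝ E] {t : ℝ≥0}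
    (φ : ElemIntegrand ι E t) (f : HilbertBasis ι ℝ U) (s : ℝ) : U →L[ℝ] E :=
  ∑ i, (Ioc (φ.a i : ℝ) (φ.b i)).indicator
    (fun _ => (innerSL ℝ (f (φ.k i))).smulRight (φ.x i)) s

/-- The integral of the step function against `dW`. -/
noncomputable def ElemIntegrand.integral {Ω ι E : Type*} [NormedAddCommGroup E] [NormedSpace ℝ E]
    {t : ℝ≥0} (φ : ElemIntegrand ι E t) (B : ι → ℝ≥0 → Ω → ℝ) (ω : Ω) : E :=
  ∑ i, (B (φ.k i) (φ.b i) ω - B (φ.k i) (φ.a i) ω) • φ.x i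

/-- `I` is (a version of) the Itô integral `∫_0^t Φ(s) dW_s` of the deterministic integrand
`Φ ∈ L²([0, t]; L_HS(U, E))`: the limit in `L²(Ω; E)` of the integrals of elementary integrands
that converge to `Φ` in `L²([0, t]; L_HS(U, E))`. -/
def IsStochasticIntegral {Ω ι U E : Type*} {mΩ : MeasurableSpace Ω} [NormedAddCommGroup U]
    [InnerProductSpace ℝ U] [NormedAddCommGroup E] [NormedSpace ℝ E]
    (P : Measure Ω) (f : HilbertBasis ι ℝ U) (B : ι → ℝ≥0 → Ω → ℝ) (t : ℝ≥0)
    (Φ : ℝ → U →L[ℝ] E) (I : Ω → E) : Prop :=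
  AEStronglyMeasurable Φ (volume.restrict (Ioc (0 : ℝ) t)) ∧ MemLp I 2 P ∧
  ∃ φ : ℕ → ElemIntegrand ι E t,
    Tendsto (fun n => ∫⁻ s in Ioc (0 : ℝ) t, hsNormSq f ((φ n).toFun f s - Φ s))
      atTop (𝓝 0) ∧
    Tendsto (fun n => eLpNorm (fun ω => (φ n).integral B ω - I ω) 2 P) atTop (𝓝 0)

/-- `u` is the mild solution of `du = A u dt + Q^{1/2} dW`, `u(0) = u₀`, where `S` is the semigroup
generated by `A`: `u(t) = S(t) u₀ + ∫_0^t S(t - s) Q^{1/2} dW_s` almost surely, for every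
`t ≥ 0`. -/
def IsMildSolution {Ω ι U H : Type*} {mΩ : MeasurableSpace Ω} [NormedAddCommGroup U]
    [InnerProductSpace ℝ U] [NormedAddCommGroup H] [NormedSpace ℝ H]
    (P : Measure Ω) (f : HilbertBasis ι ℝ U) (B : ι → ℝ≥0 → Ω → ℝ)
    (S : ℝ → H →L[ℝ] H) (Qhalf : U →L[ℝ] H) (u₀ : H) (u : ℝ≥0 → Ω → H) : Prop :=
  ∀ t : ℝ≥0, ∃ I : Ω → H,
    IsStochasticIntegral P f B t (fun s => S (t - s) ∘L Qhalf) I ∧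
    u t =ᵐ[P] fun ω => S t u₀ + I ω

/-! ### Malliavin derivative and Malliavin covariance operator -/

/-- A smooth cylindrical `E`-valued functional
`∑ j, g_j(W(h_1), …, W(h_n)) v_j`, where `W(h) = ∫_0^t ⟪h(s), dW_s⟫` for `h ∈ L²([0, t]; U)` and
the `g_j` are smooth and, with all their derivatives, of polynomial growth. -/
structure SmoothFunctional {Ω ι U : Type*} {mΩ : MeasurableSpace Ω} [NormedAddCommGroup U]
    [InnerProductSpace ℝ U] (E : Type*) (P : Measure Ω) (f : HilbertBasis ι ℝ U)
    (B : ι → ℝ≥0 → Ω → ℝ) (t : ℝ≥0) where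
  n : ℕ
  m : ℕ
  h : Fin n → ℝ → U
  X : Fin n → Ω → ℝ
  isIntegral : ∀ i, IsStochasticIntegral P f B t (fun s => innerSL ℝ (h i s)) (X i)
  g : Fin m → (Fin n → ℝ) → ℝ
  growth : ∀ j, (g j).HasTemperateGrowth
  v : Fin m → E

/-- The value of a smooth cylindrical functional. -/
noncomputable def SmoothFunctional.value {Ω ι U E : Type*} {mΩ : MeasurableSpace Ω}
    [NormedAddCommGroup U] [InnerProductSpace ℝ U] [NormedAddCommGroup E] [NormedSpace ℝ E]
    {P : Measure Ω} {f : HilbertBasis ι ℝ U} {B : ι → ℝ≥0 → Ω → ℝ} {t : ℝ≥0}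
    (G : SmoothFunctional E P f B t) (ω : Ω) : E :=
  ∑ j, G.g j (fun l => G.X l ω) • G.v j

/-- The Malliavin derivative
`D_r G = ∑ j, ∑ i, (∂_i g_j)(W(h_1), …, W(h_n)) ⟪h_i(r), ·⟫ v_j` of a smooth cylindrical
functional, an operator from `U` to `E`. -/
noncomputable def SmoothFunctional.deriv {Ω ι U E : Type*} {mΩ : MeasurableSpace Ω}
    [NormedAddCommGroup U] [InnerProductSpace ℝ U] [NormedAddCommGroup E] [NormedSpace ℝ E]
    {P : Measure Ω} {f : HilbertBasis ι ℝ U} {B : ι → ℝ≥0 → Ω → ℝ} {t : ℝ≥0}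
    (G : SmoothFunctional E P f B t) (ω : Ω) (r : ℝ) : U →L[ℝ] E :=
  ∑ j, ∑ i, fderiv ℝ (G.g j) (fun l => G.X l ω) (Pi.single i 1) •
    (innerSL ℝ (G.h i r)).smulRight (G.v j)

/-- `F ∈ 𝔻^{1,2}(E)` with Malliavin derivative `(D_r F)_{r ∈ [0, t]} = 𝒟`: the pair `(F, 𝒟)` is a
limit, in `L²(Ω; E) × L²(Ω × [0, t]; L_HS(U, E))`, of smooth cylindrical functionals together with
their derivatives. -/
def HasMalliavinDerivative {Ω ι U E : Type*} {mΩ : MeasurableSpace Ω}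
    [NormedAddCommGroup U] [InnerProductSpace ℝ U] [NormedAddCommGroup E] [NormedSpace ℝ E]
    (P : Measure Ω) (f : HilbertBasis ι ℝ U) (B : ι → ℝ≥0 → Ω → ℝ) (t : ℝ≥0)
    (F : Ω → E) (𝒟 : Ω → ℝ → U →L[ℝ] E) : Prop :=
  MemLp F 2 P ∧
  AEStronglyMeasurable (fun p : Ω × ℝ => 𝒟 p.1 p.2)
    (P.prod (volume.restrict (Ioc (0 : ℝ) t))) ∧
  ∃ G : ℕ → SmoothFunctional E P f B t,
    Tendsto (fun n => eLpNorm (fun ω => (G n).value ω - F ω) 2 P) atTop (𝓝 0) ∧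
    Tendsto (fun n => ∫⁻ p : Ω × ℝ, hsNormSq f ((G n).deriv p.1 p.2 - 𝒟 p.1 p.2)
      ∂(P.prod (volume.restrict (Ioc (0 : ℝ) t)))) atTop (𝓝 0)

/-- `γ` is the Malliavin covariance operator of `F ∈ 𝔻^{1,2}(H)`:
`γ = ∫_0^t (D_r F) (D_r F)* dr` almost surely. -/
def HasMalliavinCovariance {Ω ι U H : Type*} {mΩ : MeasurableSpace Ω}
    [NormedAddCommGroup U] [InnerProductSpace ℝ U] [CompleteSpace U]
    [NormedAddCommGroup H] [InnerProductSpace ℝ H] [CompleteSpace H]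
    (P : Measure Ω) (f : HilbertBasis ι ℝ U) (B : ι → ℝ≥0 → Ω → ℝ) (t : ℝ≥0)
    (F : Ω → H) (γ : Ω → H →L[ℝ] H) : Prop :=
  ∃ 𝒟 : Ω → ℝ → U →L[ℝ] H, HasMalliavinDerivative P f B t F 𝒟 ∧
    ∀ᵐ ω ∂P,
      IntervalIntegrable (fun r => 𝒟 ω r ∘L ContinuousLinearMap.adjoint (𝒟 ω r)) volume 0 t ∧
      γ ω = ∫ r in (0 : ℝ)..t, 𝒟 ω r ∘L ContinuousLinearMap.adjoint (𝒟 ω r)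

/-- The operator `S(s) Q^{1/2} (Q^{1/2})* S(s)*`. -/
noncomputable def covIntegrand {U H : Type*}
    [NormedAddCommGroup U] [InnerProductSpace ℝ U] [CompleteSpace U]
    [NormedAddCommGroup H] [InnerProductSpace ℝ H] [CompleteSpace H]
    (S : ℝ → H →L[ℝ] H) (Qhalf : U →L[ℝ] H) (s : ℝ) : H →L[ℝ] H :=
  S s ∘L Qhalf ∘L ContinuousLinearMap.adjoint Qhalf ∘L ContinuousLinearMap.adjoint (S s)

/-!
The Malliavin derivative of the mild solution is deterministic, `D_r u(t) = S(t - r) Q^{1/2}`, so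
its covariance operator is `∫_0^t S(t - r) Q^{1/2} (Q^{1/2})* S(t - r)* dr`, and `s = t - r` gives
the formula.

Everything rests on one regularity fact. For a Hilbert–Schmidt operator `Q` and a `C₀`-semigroup
`S`, dominated convergence over the basis shows that `s ↦ S(s) Q` is continuous in the
Hilbert–Schmidt norm, hence in operator norm (`IsC0Semigroup.continuousOn_comp`); this makes all
operator integrals Bochner integrals of continuous functions. By the same dominated convergence the
truncated Riemann step functions of `s ↦ S(t - s) Q` converge in `L²([0, t]; L_HS)`
(`exists_tendsto_elemIntegrand`), and by the Itô isometry for step functions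
(`IsCylindricalWiener.eLpNorm_integral`), read off from the covariances of Brownian increments,
their integrals are Cauchy in `L²(Ω; H)`. This gives the mild solution.

A constant plus the integral of a step function is an affine function of Brownian increments, hence
a smooth cylindrical functional whose derivative is the step function itself. So any sequence of
step functions that defines an Itô integral also exhibits its Malliavin derivative
(`IsStochasticIntegral.hasMalliavinDerivative`).

For the trace class property, `γ = ∫_0^t S(s) Q Q* S(s)* ds` is written as `W* W`, where
`W : H → L²([0, t]; U)`, `(W x)(s) = (S(s) Q)* x`, is Hilbert–Schmidt. Expanding in a Hilbert basis
`g` of `L²([0, t]; U)` gives the nuclear representation `γ x = ∑ n, ⟪W* g n, x⟫ W* g n`.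

If `A` also generates a group `T`, then for `x ∈ D(A)` the continuous curve `s ↦ T(-s) S(s) x` has
right derivative zero, so `T = S` on the dense set `D(A)` and hence everywhere for nonnegative
times (`IsC0Group.eq_of_generator`). The results on `S` apply to the semigroup `r ↦ T(-r)` as well,
and `S(t - r) = T(t) T(-r)` yields the factorization `γ = Y_t C_t Y_t*`.
-/

/-! ### Hilbert–Schmidt norms -/

section HilbertSchmidt

variable {ι U H : Type*} [NormedAddCommGroup U] [InnerProductSpace ℝ U]
  [NormedAddCommGroup H] [InnerProductSpace ℝ H]

/-- Parseval's identity, in `[0, ∞]`. -/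
lemma HilbertBasis.tsum_enorm_inner_sq (b : HilbertBasis ι ℝ H) (x : H) :
    ∑' i, ‖inner ℝ (b i) x‖ₑ ^ 2 = ‖x‖ₑ ^ 2 := by
  have h := b.hasSum_inner_mul_inner x x
  have h2 : ∀ i, inner ℝ x (b i) * inner ℝ (b i) x = ‖inner ℝ (b i) x‖ ^ 2 := fun i => by
    rw [real_inner_comm, Real.norm_eq_abs, sq_abs, sq]
  simp only [h2, real_inner_self_eq_norm_sq] at h
  have h3 := ENNReal.ofReal_tsum_of_nonneg (fun i => sq_nonneg ‖inner ℝ (b i) x‖) h.summable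
  rw [h.tsum_eq] at h3
  simpa [ENNReal.ofReal_pow, -Real.norm_eq_abs, -sq_abs] using h3.symm

/-- An operator and its adjoint have the same Hilbert–Schmidt norm, whichever bases are used. -/
lemma hsNormSq_adjoint [CompleteSpace U] [CompleteSpace H] {κ : Type*}
    (f : HilbertBasis ι ℝ U) (e : HilbertBasis κ ℝ H) (L : U →L[ℝ] H) :
    hsNormSq e (ContinuousLinearMap.adjoint L) = hsNormSq f L := by
  have h1 : ∀ j, ‖ContinuousLinearMap.adjoint L (e j)‖ₑ ^ 2 =
      ∑' k, ‖inner ℝ (L (f k)) (e j)‖ₑ ^ 2 := fun j => by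
    rw [← f.tsum_enorm_inner_sq]
    simp only [ContinuousLinearMap.adjoint_inner_right]
  have h2 : ∀ k, ‖L (f k)‖ₑ ^ 2 = ∑' j, ‖inner ℝ (L (f k)) (e j)‖ₑ ^ 2 := fun k => by
    rw [← e.tsum_enorm_inner_sq]
    simp only [real_inner_comm]
  simp only [hsNormSq, h1, h2]
  exact ENNReal.tsum_comm

lemma enorm_sq_le_hsNormSq [CompleteSpace U] [CompleteSpace H]
    (f : HilbertBasis ι ℝ U) (L : U →L[ℝ] H) : ‖L‖ₑ ^ 2 ≤ hsNormSq f L := by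
  by_cases hL : hsNormSq f L = ∞
  · simp [hL]
  have key : ∀ y : H, ‖ContinuousLinearMap.adjoint L y‖ₑ ^ 2 ≤ hsNormSq f L * ‖y‖ₑ ^ 2 := by
    intro y
    rw [← f.tsum_enorm_inner_sq, hsNormSq, ← ENNReal.tsum_mul_right]
    refine ENNReal.tsum_le_tsum fun k => ?_
    rw [ContinuousLinearMap.adjoint_inner_right, ← mul_pow]
    gcongr
    simpa [enorm_eq_nnnorm, ← ENNReal.coe_mul] using nnnorm_inner_le_nnnorm (𝕜 := ℝ) (L (f k)) y
  have h3 : ‖ContinuousLinearMap.adjoint L‖ ≤ √(hsNormSq f L).toReal := by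
    refine ContinuousLinearMap.opNorm_le_bound _ (Real.sqrt_nonneg _) fun y => ?_
    have := ENNReal.toReal_mono (by finiteness) (key y)
    simp only [ENNReal.toReal_mul, ENNReal.toReal_pow, toReal_enorm] at this
    rw [← Real.sqrt_sq (norm_nonneg y), ← Real.sqrt_mul ENNReal.toReal_nonneg]
    exact Real.le_sqrt_of_sq_le this
  rw [LinearIsometryEquiv.norm_map] at h3
  have h4 : ‖L‖ ^ 2 ≤ (hsNormSq f L).toReal := by
    calc ‖L‖ ^ 2 ≤ √(hsNormSq f L).toReal ^ 2 := by gcongr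
      _ = _ := Real.sq_sqrt ENNReal.toReal_nonneg
  rw [← ofReal_norm, ← ENNReal.ofReal_pow (norm_nonneg _)]
  exact ENNReal.ofReal_le_of_le_toReal h4

lemma hsNormSq_sub_comm (f : HilbertBasis ι ℝ U) (L M : U →L[ℝ] H) :
    hsNormSq f (L - M) = hsNormSq f (M - L) := by
  simp only [hsNormSq, sub_apply]
  exact tsum_congr fun k => by rw [← enorm_neg, neg_sub]

lemma hsNormSq_add_le (f : HilbertBasis ι ℝ U) (L M : U →L[ℝ] H) :
    hsNormSq f (L + M) ≤ 2 * (hsNormSq f L + hsNormSq f M) := by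
  simp only [hsNormSq, ← ENNReal.tsum_add, ← ENNReal.tsum_mul_left]
  refine ENNReal.tsum_le_tsum fun k => ?_
  have h := ENNReal.rpow_add_le_mul_rpow_add_rpow (‖L (f k)‖ₑ) (‖M (f k)‖ₑ) (p := 2) (by norm_num)
  norm_num at h
  refine le_trans ?_ h
  gcongr
  exact enorm_add_le _ _

lemma hsNormSq_le_of_norm_le (f : HilbertBasis ι ℝ U) {L M : U →L[ℝ] H} {C : ℝ}
    (h : ∀ k, ‖L (f k)‖ ≤ C * ‖M (f k)‖) :
    hsNormSq f L ≤ ENNReal.ofReal C ^ 2 * hsNormSq f M := by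
  simp only [hsNormSq, ← ENNReal.tsum_mul_left, ← mul_pow]
  refine ENNReal.tsum_le_tsum fun k => ?_
  gcongr
  rw [← ofReal_norm, ← ofReal_norm, ← ENNReal.ofReal_mul' (norm_nonneg _)]
  exact ENNReal.ofReal_le_ofReal (h k)

lemma summable_of_hsNormSq_lt_top {f : HilbertBasis ι ℝ U} {L : U →L[ℝ] H}
    (h : hsNormSq f L < ∞) : Summable fun k => ‖L (f k)‖ ^ 2 := by
  have := ENNReal.summable_toReal h.ne
  simpa using this

/-- Dominated convergence in the Hilbert–Schmidt norm. -/
lemma tendsto_hsNormSq_sub {α : Type*} {l : Filter α} {f : HilbertBasis ι ℝ U}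
    {L : α → U →L[ℝ] H} {L₀ M : U →L[ℝ] H} {C : ℝ} (hM : hsNormSq f M < ∞)
    (hbound : ∀ᶠ a in l, ∀ k, ‖(L a - L₀) (f k)‖ ≤ C * ‖M (f k)‖)
    (hlim : ∀ k, Tendsto (fun a => L a (f k)) l (𝓝 (L₀ (f k)))) :
    Tendsto (fun a => hsNormSq f (L a - L₀)) l (𝓝 0) := by
  have hs : Summable fun k => C ^ 2 * ‖M (f k)‖ ^ 2 := (summable_of_hsNormSq_lt_top hM).mul_left _
  have hb : ∀ᶠ a in l, ∀ k, ‖‖(L a - L₀) (f k)‖ ^ 2‖ ≤ C ^ 2 * ‖M (f k)‖ ^ 2 := by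
    filter_upwards [hbound] with a ha k
    rw [Real.norm_of_nonneg (sq_nonneg _), ← mul_pow]
    gcongr
    exact ha k
  have ht := tendsto_tsum_of_dominated_convergence (𝓕 := l)
    (f := fun a k => ‖(L a - L₀) (f k)‖ ^ 2) (g := fun _ => 0) hs (fun k => by
      have := ((hlim k).sub_const (L₀ (f k))).norm.pow 2
      simpa using this) hb
  have ht' := ENNReal.tendsto_ofReal ht
  simp only [tsum_zero, ENNReal.ofReal_zero] at ht'
  refine ht'.congr' ?_
  filter_upwards [hb] with a ha
  rw [ENNReal.ofReal_tsum_of_nonneg (fun _ => sq_nonneg _)]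
  · simp [hsNormSq, ENNReal.ofReal_pow]
  · exact Summable.of_norm_bounded hs ha

end HilbertSchmidt

/-! ### Strongly continuous semigroups -/

section Semigroup

variable {ι U H : Type*} [NormedAddCommGroup U] [InnerProductSpace ℝ U]
  [NormedAddCommGroup H] [InnerProductSpace ℝ H]

lemma IsC0Semigroup.exists_norm_le [CompleteSpace H] {S : ℝ → H →L[ℝ] H}
    (hS : IsC0Semigroup S) (t : ℝ) :
    ∃ M, 0 ≤ M ∧ ∀ s ∈ Icc 0 t, ‖S s‖ ≤ M := by
  obtain ⟨M, hM⟩ := banach_steinhaus (g := fun s : Icc 0 t => S s) fun x => by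
    obtain ⟨C, hC⟩ := isCompact_Icc.exists_bound_of_continuousOn
      ((hS.continuousOn x).mono fun s (hs : s ∈ Icc 0 t) => hs.1)
    exact ⟨C, fun i => hC i i.2⟩
  exact ⟨max M 0, le_max_right _ _, fun s hs => (hM ⟨s, hs⟩).trans (le_max_left _ _)⟩

lemma IsC0Group.isC0Semigroup {T : ℝ → H →L[ℝ] H} (hT : IsC0Group T) : IsC0Semigroup T :=
  ⟨hT.map_zero, fun s t _ _ => hT.map_add s t, fun x => (hT.continuous x).continuousOn⟩

lemma IsC0Group.neg {T : ℝ → H →L[ℝ] H} (hT : IsC0Group T) : IsC0Group fun r => T (-r) :=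
  ⟨by simpa using hT.map_zero, fun s t => by rw [neg_add, hT.map_add],
    fun x => (hT.continuous x).comp continuous_neg⟩

lemma IsC0Group.comp_neg {T : ℝ → H →L[ℝ] H} (hT : IsC0Group T) (r : ℝ) :
    T r ∘L T (-r) = ContinuousLinearMap.id ℝ H := by
  rw [← hT.map_add, add_neg_cancel, hT.map_zero]

/-- A `C₀`-semigroup composed with a Hilbert–Schmidt operator is continuous in operator norm. -/
lemma IsC0Semigroup.continuousOn_comp [CompleteSpace U] [CompleteSpace H] {S : ℝ → H →L[ℝ] H}
    (hS : IsC0Semigroup S) {f : HilbertBasis ι ℝ U} {Q : U →L[ℝ] H} (hQ : hsNormSq f Q < ∞) :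
    ContinuousOn (fun s => S s ∘L Q) (Ici 0) := by
  intro s₀ hs₀
  obtain ⟨M, hM0, hM⟩ := hS.exists_norm_le (s₀ + 1)
  have hlim : Tendsto (fun s => hsNormSq f (S s ∘L Q - S s₀ ∘L Q)) (𝓝[Ici 0] s₀) (𝓝 0) := by
    refine tendsto_hsNormSq_sub (C := M + M) hQ ?_
      fun k => hS.continuousOn (Q (f k)) s₀ hs₀
    filter_upwards [self_mem_nhdsWithin,
      mem_nhdsWithin_of_mem_nhds (Iio_mem_nhds (lt_add_one s₀))] with s hs hs1 k
    have h1 := (S s).le_of_opNorm_le (hM s ⟨hs, le_of_lt hs1⟩) (Q (f k))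
    have h2 := (S s₀).le_of_opNorm_le (hM s₀ ⟨hs₀, by linarith⟩) (Q (f k))
    rw [add_mul]
    exact (norm_sub_le _ _).trans (add_le_add h1 h2)
  have h2 : Tendsto (fun s => ‖S s ∘L Q - S s₀ ∘L Q‖ₑ ^ 2) (𝓝[Ici 0] s₀) (𝓝 0) :=
    tendsto_of_tendsto_of_tendsto_of_le_of_le tendsto_const_nhds hlim (fun _ => zero_le)
      fun s => enorm_sq_le_hsNormSq f _
  rw [ContinuousWithinAt, tendsto_iff_edist_tendsto_0]
  have h3 := (ENNReal.continuous_rpow_const (y := (1 / 2 : ℝ))).tendsto 0 |>.comp h2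
  rw [ENNReal.zero_rpow_of_pos (by norm_num)] at h3
  refine h3.congr fun s => ?_
  simp only [Function.comp, edist_eq_enorm_sub]
  rw [← ENNReal.rpow_natCast, ← ENNReal.rpow_mul]
  norm_num

lemma covIntegrand_eq [CompleteSpace U] [CompleteSpace H]
    (S : ℝ → H →L[ℝ] H) (Q : U →L[ℝ] H) (s : ℝ) :
    covIntegrand S Q s = (S s ∘L Q) ∘L ContinuousLinearMap.adjoint (S s ∘L Q) := by
  rw [covIntegrand, ContinuousLinearMap.adjoint_comp]
  rfl

lemma IsC0Semigroup.continuousOn_covIntegrand [CompleteSpace U] [CompleteSpace H]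
    {S : ℝ → H →L[ℝ] H} (hS : IsC0Semigroup S) {f : HilbertBasis ι ℝ U} {Q : U →L[ℝ] H} (hQ : hsNormSq f Q < ∞) :
    ContinuousOn (covIntegrand S Q) (Ici 0) := by
  have h := hS.continuousOn_comp hQ
  refine ContinuousOn.congr ?_ fun s _ => covIntegrand_eq S Q s
  exact h.clm_comp (ContinuousLinearMap.adjoint.continuous.comp_continuousOn h)

lemma IsC0Semigroup.intervalIntegrable_covIntegrand [CompleteSpace U] [CompleteSpace H]
    {S : ℝ → H →L[ℝ] H} (hS : IsC0Semigroup S) {f : HilbertBasis ι ℝ U} {Q : U →L[ℝ] H} (hQ : hsNormSq f Q < ∞)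
    {t : ℝ} (ht : 0 ≤ t) : IntervalIntegrable (covIntegrand S Q) volume 0 t := by
  refine ContinuousOn.intervalIntegrable ((hS.continuousOn_covIntegrand hQ).mono ?_)
  rw [uIcc_of_le ht]
  exact Icc_subset_Ici_self

end Semigroup

/-! ### The Itô isometry for elementary integrands -/

namespace ElemIntegrand

variable {ι U E H Ω : Type*} [NormedAddCommGroup U] [InnerProductSpace ℝ U]
  [NormedAddCommGroup E] [NormedSpace ℝ E]
  [NormedAddCommGroup H] [InnerProductSpace ℝ H] {t : ℝ≥0}

/-- An elementary integrand whose terms are indexed by an arbitrary finite type. -/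
noncomputable def ofFintype {α : Type*} [Fintype α] (a b : α → ℝ≥0) (hab : ∀ i, a i ≤ b i)
    (hb : ∀ i, b i ≤ t) (k : α → ι) (x : α → E) : ElemIntegrand ι E t where
  n := Fintype.card α
  a i := a ((Fintype.equivFin α).symm i)
  b i := b ((Fintype.equivFin α).symm i)
  a_le_b _ := hab _
  b_le _ := hb _
  k i := k ((Fintype.equivFin α).symm i)
  x i := x ((Fintype.equivFin α).symm i)

lemma toFun_ofFintype {α : Type*} [Fintype α] (a b : α → ℝ≥0) (hab : ∀ i, a i ≤ b i)
    (hb : ∀ i, b i ≤ t) (k : α → ι) (x : α → E) (f : HilbertBasis ι ℝ U) (s : ℝ) :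
    (ofFintype a b hab hb k x).toFun f s = ∑ i, (Ioc (a i : ℝ) (b i)).indicator
      (fun _ => (innerSL ℝ (f (k i))).smulRight (x i)) s :=
  (Fintype.equivFin α).symm.sum_comp fun i => (Ioc (a i : ℝ) (b i)).indicator
      (fun _ => (innerSL ℝ (f (k i))).smulRight (x i)) s

lemma integral_ofFintype {α : Type*} [Fintype α] (a b : α → ℝ≥0) (hab : ∀ i, a i ≤ b i)
    (hb : ∀ i, b i ≤ t) (k : α → ι) (x : α → E) (B : ι → ℝ≥0 → Ω → ℝ) (ω : Ω) :
    (ofFintype a b hab hb k x).integral B ω =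
      ∑ i, (B (k i) (b i) ω - B (k i) (a i) ω) • x i :=
  (Fintype.equivFin α).symm.sum_comp fun i => (B (k i) (b i) ω - B (k i) (a i) ω) • x i

/-- The difference of two elementary integrands. -/
noncomputable def sub (φ ψ : ElemIntegrand ι E t) : ElemIntegrand ι E t :=
  ofFintype (α := Fin φ.n ⊕ Fin ψ.n) (Sum.elim φ.a ψ.a) (Sum.elim φ.b ψ.b)
    (by rintro (i | i) <;> simp [a_le_b]) (by rintro (i | i) <;> simp [b_le])
    (Sum.elim φ.k ψ.k) (Sum.elim φ.x fun i => -ψ.x i)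

lemma toFun_sub (φ ψ : ElemIntegrand ι E t) (f : HilbertBasis ι ℝ U) (s : ℝ) :
    (φ.sub ψ).toFun f s = φ.toFun f s - ψ.toFun f s := by
  rw [sub, toFun_ofFintype, Fintype.sum_sum_type, toFun, toFun, sub_eq_add_neg,
    ← Finset.sum_neg_distrib]
  congr 1
  refine Finset.sum_congr rfl fun i _ => ?_
  simp only [Sum.elim_inr]
  by_cases hs : s ∈ Ioc (ψ.a i : ℝ) (ψ.b i)
  · rw [indicator_of_mem hs, indicator_of_mem hs]
    ext; simp
  · rw [indicator_of_notMem hs, indicator_of_notMem hs, neg_zero]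

lemma integral_sub (φ ψ : ElemIntegrand ι E t) (B : ι → ℝ≥0 → Ω → ℝ) (ω : Ω) :
    (φ.sub ψ).integral B ω = φ.integral B ω - ψ.integral B ω := by
  rw [sub, integral_ofFintype, Fintype.sum_sum_type, integral, integral, sub_eq_add_neg,
    ← Finset.sum_neg_distrib]
  simp

open Classical in
lemma toFun_apply (φ : ElemIntegrand ι E t) (f : HilbertBasis ι ℝ U) (s : ℝ) (k : ι) :
    φ.toFun f s (f k) = ∑ i, (Ioc (φ.a i : ℝ) (φ.b i)).indicator (fun _ => (1 : ℝ)) s •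
      (if φ.k i = k then φ.x i else 0) := by
  rw [toFun, sum_apply]
  refine Finset.sum_congr rfl fun i _ => ?_
  have h := orthonormal_iff_ite.1 f.orthonormal (φ.k i) k
  by_cases hs : s ∈ Ioc (φ.a i : ℝ) (φ.b i)
  · rw [indicator_of_mem hs, indicator_of_mem hs, ContinuousLinearMap.smulRight_apply,
      innerSL_apply_apply, h]
    split_ifs <;> simp
  · simp [indicator_of_notMem hs]

open Classical in
/-- The pointwise Hilbert–Schmidt norm as a double sum over the steps, with the nonnegativity of
that real sum, which `ENNReal.ofReal` would otherwise truncate. -/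
lemma hsNormSq_toFun (φ : ElemIntegrand ι H t) (f : HilbertBasis ι ℝ U) (s : ℝ) :
    0 ≤ ∑ i, ∑ j, (if φ.k i = φ.k j then (inner ℝ (φ.x i) (φ.x j) : ℝ) else 0) *
      (Ioc (φ.a i : ℝ) (φ.b i) ∩ Ioc (φ.a j : ℝ) (φ.b j)).indicator (fun _ => (1 : ℝ)) s ∧
    hsNormSq f (φ.toFun f s) = ENNReal.ofReal (∑ i, ∑ j,
      (if φ.k i = φ.k j then (inner ℝ (φ.x i) (φ.x j) : ℝ) else 0) *
      (Ioc (φ.a i : ℝ) (φ.b i) ∩ Ioc (φ.a j : ℝ) (φ.b j)).indicator (fun _ => (1 : ℝ)) s) := by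
  have key : ∑ k ∈ Finset.univ.image φ.k, ‖φ.toFun f s (f k)‖ ^ 2 = ∑ i, ∑ j,
      (if φ.k i = φ.k j then (inner ℝ (φ.x i) (φ.x j) : ℝ) else 0) *
      (Ioc (φ.a i : ℝ) (φ.b i) ∩ Ioc (φ.a j : ℝ) (φ.b j)).indicator (fun _ => (1 : ℝ)) s := by
    simp only [toFun_apply, ← real_inner_self_eq_norm_sq, sum_inner, inner_sum]
    rw [Finset.sum_comm]
    refine Finset.sum_congr rfl fun i _ => ?_
    rw [Finset.sum_comm]
    refine Finset.sum_congr rfl fun j _ => ?_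
    have h1 : ∀ k, (inner ℝ ((Ioc (φ.a j : ℝ) (φ.b j)).indicator (fun _ => (1 : ℝ)) s •
        (if φ.k j = k then φ.x j else 0)) ((Ioc (φ.a i : ℝ) (φ.b i)).indicator
        (fun _ => (1 : ℝ)) s • (if φ.k i = k then φ.x i else 0)) : ℝ) =
        if φ.k i = k then (if φ.k i = φ.k j then (inner ℝ (φ.x i) (φ.x j) : ℝ) else 0) *
          (Ioc (φ.a i : ℝ) (φ.b i) ∩ Ioc (φ.a j : ℝ) (φ.b j)).indicator (fun _ => (1 : ℝ)) s
        else 0 := by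
      intro k
      rw [← Set.indicator_indicator, real_inner_smul_left, real_inner_smul_right]
      by_cases h1 : φ.k i = k
      · subst h1
        by_cases h2 : φ.k i = φ.k j
        · simp only [h2, if_true, Set.indicator]
          split_ifs <;> simp [real_inner_comm]
        · simp [h2, Ne.symm h2]
      · simp [h1]
    simp only [real_inner_comm] at h1 ⊢
    simp only [h1, Finset.sum_ite_eq, Finset.mem_image, Finset.mem_univ, true_and,
      exists_apply_eq_apply, if_true]
  rw [← key]
  refine ⟨Finset.sum_nonneg fun _ _ => sq_nonneg _, ?_⟩
  rw [hsNormSq, tsum_eq_sum (s := Finset.univ.image φ.k),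
    ENNReal.ofReal_sum_of_nonneg fun _ _ => sq_nonneg _]
  · simp [ENNReal.ofReal_pow]
  · intro k hk
    rw [toFun_apply, Finset.sum_eq_zero]
    · simp
    · intro i _
      have : φ.k i ≠ k := fun h => hk (Finset.mem_image.2 ⟨i, Finset.mem_univ _, h⟩)
      simp [this]

end ElemIntegrand

section ItoIsometry

variable {ι U H Ω : Type*} [NormedAddCommGroup U] [InnerProductSpace ℝ U]
  [NormedAddCommGroup H] [InnerProductSpace ℝ H]
  {mΩ : MeasurableSpace Ω} {P : Measure Ω}
  {ℱ : Filtration ℝ≥0 mΩ} {B : ι → ℝ≥0 → Ω → ℝ} {t : ℝ≥0}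

lemma IsCylindricalWiener.memLp (hB : IsCylindricalWiener P ℱ B) (k : ι) (s : ℝ≥0) :
    MemLp (B k s) 2 P :=
  ((hB.brownian k).hasLaw_eval s).hasGaussianLaw.memLp_two

lemma IsCylindricalWiener.memLp_sub (hB : IsCylindricalWiener P ℱ B) (k : ι) (a b : ℝ≥0) :
    MemLp (fun ω => B k b ω - B k a ω) 2 P :=
  (hB.memLp k b).sub (hB.memLp k a)

lemma volumeReal_Ioc_inter_Ioc {a b c d : ℝ} (hab : a ≤ b) (hcd : c ≤ d) :
    volume.real (Ioc a b ∩ Ioc c d) = min b d - min b c - min a d + min a c := by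
  rw [Ioc_inter_Ioc, Measure.real, Real.volume_Ioc, ENNReal.toReal_ofReal']
  grind

open Classical in
/-- The covariances of the increments: those of white noise in time and independence in the
coordinates. -/
lemma IsCylindricalWiener.integral_increment_mul [IsProbabilityMeasure P]
    (hB : IsCylindricalWiener P ℱ B) (k l : ι) {a b c d : ℝ≥0} (hab : a ≤ b) (hcd : c ≤ d) :
    ∫ ω, (B k b ω - B k a ω) * (B l d ω - B l c ω) ∂P =
      if k = l then volume.real (Ioc (a : ℝ) b ∩ Ioc (c : ℝ) d) else 0 := by
  have hmean : ∀ (k : ι) (a b : ℝ≥0), ∫ ω, (B k b ω - B k a ω) ∂P = 0 := fun k a b => by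
    rw [MeasureTheory.integral_sub ((hB.brownian k).integrable_eval _)
      ((hB.brownian k).integrable_eval _),
      (hB.brownian k).integral_eval, (hB.brownian k).integral_eval, sub_zero]
  have hcov := covariance_eq_sub (hB.memLp_sub k a b) (hB.memLp_sub l c d)
  rw [hmean, zero_mul, sub_zero] at hcov
  refine hcov.symm.trans ?_
  split_ifs with h
  · subst h
    rw [volumeReal_Ioc_inter_Ioc (by exact_mod_cast hab) (by exact_mod_cast hcd),
      covariance_fun_sub_fun_sub (hB.memLp _ _) (hB.memLp _ _) (hB.memLp _ _) (hB.memLp _ _)]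
    simp only [(hB.brownian k).covariance_eval, NNReal.coe_min]
  · have hi := (hB.indep.indepFun h).comp (φ := fun p : ℝ≥0 → ℝ => p b - p a)
      (ψ := fun p : ℝ≥0 → ℝ => p d - p c) (by fun_prop) (by fun_prop)
    exact hi.covariance_eq_zero (hB.memLp_sub k a b) (hB.memLp_sub l c d)

lemma IsCylindricalWiener.memLp_integral (hB : IsCylindricalWiener P ℱ B)
    (φ : ElemIntegrand ι H t) : MemLp (φ.integral B) 2 P :=
  memLp_finsetSum (f := fun i ω => (B (φ.k i) (φ.b i) ω - B (φ.k i) (φ.a i) ω) • φ.x i)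
    Finset.univ fun i _ => (ContinuousLinearMap.toSpanSingleton ℝ (φ.x i)).comp_memLp'
      (hB.memLp_sub (φ.k i) (φ.a i) (φ.b i))

open Classical in
lemma IsCylindricalWiener.integral_norm_sq [IsProbabilityMeasure P]
    (hB : IsCylindricalWiener P ℱ B) (φ : ElemIntegrand ι H t) :
    ∫ ω, ‖φ.integral B ω‖ ^ 2 ∂P = ∑ i, ∑ j,
      (if φ.k i = φ.k j then (inner ℝ (φ.x i) (φ.x j) : ℝ) else 0) *
        volume.real (Ioc (φ.a i : ℝ) (φ.b i) ∩ Ioc (φ.a j : ℝ) (φ.b j)) := by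
  have h1 : ∀ ω, ‖φ.integral B ω‖ ^ 2 = ∑ i, ∑ j, (inner ℝ (φ.x i) (φ.x j) : ℝ) *
      ((B (φ.k i) (φ.b i) ω - B (φ.k i) (φ.a i) ω) *
        (B (φ.k j) (φ.b j) ω - B (φ.k j) (φ.a j) ω)) := fun ω => by
    rw [← real_inner_self_eq_norm_sq, ElemIntegrand.integral, sum_inner]
    refine Finset.sum_congr rfl fun i _ => ?_
    rw [inner_sum]
    refine Finset.sum_congr rfl fun j _ => ?_
    rw [real_inner_smul_left, real_inner_smul_right]
    ring
  have hint : ∀ i j, Integrable (fun ω => (inner ℝ (φ.x i) (φ.x j) : ℝ) *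
      ((B (φ.k i) (φ.b i) ω - B (φ.k i) (φ.a i) ω) *
        (B (φ.k j) (φ.b j) ω - B (φ.k j) (φ.a j) ω))) P := fun i j =>
    ((hB.memLp_sub (φ.k i) (φ.a i) (φ.b i)).integrable_mul
      (hB.memLp_sub (φ.k j) (φ.a j) (φ.b j))).const_mul _
  simp only [h1]
  rw [integral_finsetSum _ fun i _ => integrable_finsetSum _ fun j _ => hint i j]
  refine Finset.sum_congr rfl fun i _ => ?_
  rw [integral_finsetSum _ fun j _ => hint i j]
  refine Finset.sum_congr rfl fun j _ => ?_
  rw [integral_const_mul, hB.integral_increment_mul _ _ (φ.a_le_b i) (φ.a_le_b j)]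
  split_ifs <;> simp

/-- The **Itô isometry** for elementary integrands. -/
lemma IsCylindricalWiener.eLpNorm_integral [IsProbabilityMeasure P]
    (hB : IsCylindricalWiener P ℱ B) (f : HilbertBasis ι ℝ U) (φ : ElemIntegrand ι H t) :
    eLpNorm (φ.integral B) 2 P ^ 2 = ∫⁻ s in Ioc (0 : ℝ) t, hsNormSq f (φ.toFun f s) := by
  classical
  have hL : eLpNorm (φ.integral B) 2 P ^ 2 =
      ENNReal.ofReal (∫ ω, ‖φ.integral B ω‖ ^ 2 ∂P) := by
    rw [ofReal_integral_eq_lintegral_ofReal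
      ((memLp_two_iff_integrable_sq_norm (hB.memLp_integral φ).1).1 (hB.memLp_integral φ))
      (ae_of_all _ fun _ => sq_nonneg _)]
    have h := eLpNorm_nnreal_pow_eq_lintegral (f := φ.integral B) (μ := P) (p := 2) (by norm_num)
    simpa [ENNReal.ofReal_pow] using h
  have hint : ∀ i j, Integrable (fun s : ℝ =>
      (if φ.k i = φ.k j then (inner ℝ (φ.x i) (φ.x j) : ℝ) else 0) *
        (Ioc (φ.a i : ℝ) (φ.b i) ∩ Ioc (φ.a j : ℝ) (φ.b j)).indicator (fun _ => (1 : ℝ)) s)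
      (volume.restrict (Ioc (0 : ℝ) t)) := fun i j =>
    ((integrable_const 1).indicator (measurableSet_Ioc.inter measurableSet_Ioc)).const_mul _
  simp only [(φ.hsNormSq_toFun f _).2]
  rw [hL, hB.integral_norm_sq, ← ofReal_integral_eq_lintegral_ofReal
    (integrable_finsetSum _ fun i _ => integrable_finsetSum _ fun j _ => hint i j)
    (ae_of_all _ fun s => (φ.hsNormSq_toFun f s).1),
    integral_finsetSum _ fun i _ => integrable_finsetSum _ fun j _ => hint i j]
  congr 1
  refine Finset.sum_congr rfl fun i _ => ?_
  rw [integral_finsetSum _ fun j _ => hint i j]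
  refine Finset.sum_congr rfl fun j _ => ?_
  have hsub : Ioc (φ.a i : ℝ) (φ.b i) ∩ Ioc (φ.a j : ℝ) (φ.b j) ⊆ Ioc (0 : ℝ) t := fun s hs =>
    ⟨(φ.a i).2.trans_lt hs.1.1, hs.1.2.trans (by exact_mod_cast φ.b_le i)⟩
  rw [integral_const_mul, MeasureTheory.integral_indicator_const _
    (measurableSet_Ioc.inter measurableSet_Ioc), measureReal_restrict_apply
    (measurableSet_Ioc.inter measurableSet_Ioc), inter_eq_left.2 hsub, smul_eq_mul, mul_one]

end ItoIsometry

/-! ### Existence of the stochastic convolution -/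

section Riemann

variable {ι U H : Type*} [NormedAddCommGroup U] [InnerProductSpace ℝ U]
  [NormedAddCommGroup H] [InnerProductSpace ℝ H] {t : ℝ≥0}

/-- The truncated Riemann step function of `Φ`: on the `i`-th of `n + 1` equal subintervals of
`(0, t]` it is `Φ` at the left endpoint, composed with the projection onto `span {f_k | k ∈ K}`. -/
noncomputable def riemannIntegrand (t : ℝ≥0) (f : HilbertBasis ι ℝ U) (Φ : ℝ → U →L[ℝ] H)
    (K : Finset ι) (n : ℕ) : ElemIntegrand ι H t :=
  ElemIntegrand.ofFintype (α := Fin (n + 1) × K)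
    (fun p => t * (p.1 : ℕ) / (n + 1)) (fun p => t * ((p.1 : ℕ) + 1) / (n + 1))
    (fun p => by gcongr; simp)
    (fun p => by
      rw [div_le_iff₀ (by positivity)]
      gcongr
      exact_mod_cast Nat.le_of_lt_succ p.1.2)
    (fun p => p.2) (fun p => Φ ((t * (p.1 : ℕ) / (n + 1) : ℝ≥0) : ℝ) (f p.2))

open Classical in
lemma riemannIntegrand_apply (f : HilbertBasis ι ℝ U) (Φ : ℝ → U →L[ℝ] H)
    (K : Finset ι) (n : ℕ) {s : ℝ} (hs : s ∈ Ioc (0 : ℝ) t) :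
    ∃ c ∈ Icc (0 : ℝ) t, |c - s| ≤ t / (n + 1) ∧
      ∀ l, (riemannIntegrand t f Φ K n).toFun f s (f l) = if l ∈ K then Φ c (f l) else 0 := by
  have ht : (0 : ℝ) < t := hs.1.trans_le hs.2
  have hn : (0 : ℝ) < n + 1 := by positivity
  have hy : 0 < s * (n + 1) / t := div_pos (mul_pos hs.1 hn) ht
  have hmem : ∀ i : ℕ, s ∈ Ioc ((t * i / (n + 1) : ℝ≥0) : ℝ) ((t * (i + 1) / (n + 1) : ℝ≥0) : ℝ) ↔
      ⌈s * (n + 1) / t⌉₊ = i + 1 := fun i => by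
    rw [Nat.ceil_eq_iff (Nat.succ_ne_zero i), mem_Ioc]
    push_cast
    rw [div_lt_iff₀ hn, le_div_iff₀ hn, lt_div_iff₀ ht, div_le_iff₀ ht]
    simp only [mul_comm]
  obtain ⟨m, hm⟩ : ∃ m, ⌈s * (n + 1) / t⌉₊ = m + 1 :=
    Nat.exists_eq_succ_of_ne_zero (Nat.ceil_pos.2 hy).ne'
  have hmn : m < n + 1 := by
    rw [← Nat.add_one_le_iff, ← hm, Nat.ceil_le, div_le_iff₀ ht, mul_comm]
    push_cast
    gcongr
    exact hs.2
  have hsm := (hmem m).2 hm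
  refine ⟨((t * m / (n + 1) : ℝ≥0) : ℝ), ⟨NNReal.coe_nonneg _, hsm.1.le.trans hs.2⟩,
    ?_, fun l => ?_⟩
  · rw [abs_sub_comm, abs_of_nonneg (by linarith [hsm.1])]
    have h2 := hsm.2
    push_cast at h2 ⊢
    rw [mul_add, add_div, mul_one] at h2
    linarith
  · rw [riemannIntegrand, ElemIntegrand.toFun_ofFintype, Fintype.sum_prod_type,
      Finset.sum_eq_single ⟨m, hmn⟩]
    · have h1 : ∀ k : K, (Ioc ((t * m / (n + 1) : ℝ≥0) : ℝ)
          ((t * (m + 1) / (n + 1) : ℝ≥0) : ℝ)).indicator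
          (fun _ => (innerSL ℝ (f k)).smulRight (Φ ((t * m / (n + 1) : ℝ≥0) : ℝ) (f k))) s (f l) =
          if (k : ι) = l then Φ ((t * m / (n + 1) : ℝ≥0) : ℝ) (f l) else 0 := fun k => by
        rw [indicator_of_mem hsm, ContinuousLinearMap.smulRight_apply, innerSL_apply_apply,
          orthonormal_iff_ite.1 f.orthonormal]
        split_ifs with h
        · rw [h, one_smul]
        · rw [zero_smul]
      rw [sum_apply]
      simp only [h1]
      rw [Finset.sum_coe_sort K fun k => if k = l then _ else _, Finset.sum_ite_eq']
    · intro j _ hj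
      refine Finset.sum_eq_zero fun k _ => indicator_of_notMem (fun h => hj ?_) _
      ext
      have := (hmem j).1 h
      simp only
      omega
    · simp

lemma ElemIntegrand.stronglyMeasurable_toFun (φ : ElemIntegrand ι H t) (f : HilbertBasis ι ℝ U) :
    StronglyMeasurable (φ.toFun f) := by
  unfold ElemIntegrand.toFun
  exact Finset.stronglyMeasurable_fun_sum _ fun i _ =>
    stronglyMeasurable_const.indicator measurableSet_Ioc

lemma ElemIntegrand.aemeasurable_hsNormSq_sub [Countable ι] (φ : ElemIntegrand ι H t)
    (f : HilbertBasis ι ℝ U) {Φ : ℝ → U →L[ℝ] H} {μ : Measure ℝ} (hm : AEStronglyMeasurable Φ μ) :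
    AEMeasurable (fun s => hsNormSq f (φ.toFun f s - Φ s)) μ := by
  unfold hsNormSq
  exact AEMeasurable.tsum fun k => ((((φ.stronglyMeasurable_toFun f).aestronglyMeasurable.sub
    hm).apply_continuousLinearMap (f k)).enorm).pow_const 2

/-- A deterministic integrand that is strongly continuous and dominated by a Hilbert–Schmidt
operator is the limit of its truncated Riemann step functions. -/
lemma exists_tendsto_elemIntegrand [Countable ι] {f : HilbertBasis ι ℝ U}
    {Q : U →L[ℝ] H} (hQ : hsNormSq f Q < ∞) {Φ : ℝ → U →L[ℝ] H} {C : ℝ}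
    (hm : AEStronglyMeasurable Φ (volume.restrict (Ioc (0 : ℝ) t)))
    (hb : ∀ s ∈ Icc (0 : ℝ) t, ∀ k, ‖Φ s (f k)‖ ≤ C * ‖Q (f k)‖)
    (hc : ∀ k, ContinuousOn (fun s => Φ s (f k)) (Icc (0 : ℝ) t)) :
    ∃ φ : ℕ → ElemIntegrand ι H t,
      Tendsto (fun n => ∫⁻ s in Ioc (0 : ℝ) t, hsNormSq f ((φ n).toFun f s - Φ s))
        atTop (𝓝 0) := by
  classical
  obtain ⟨e, he⟩ := exists_injective_nat ι
  let K : ℕ → Finset ι := fun n => (Finset.range n).preimage e he.injOn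
  have hK : ∀ k, ∀ᶠ n in atTop, k ∈ K n := fun k => by
    filter_upwards [eventually_gt_atTop (e k)] with n hn
    simpa [K] using hn
  let φ : ℕ → ElemIntegrand ι H t := fun n => riemannIntegrand t f Φ (K n) n
  have hbound : ∀ s ∈ Ioc (0 : ℝ) t, ∀ n k,
      ‖((φ n).toFun f s - Φ s) (f k)‖ ≤ (C + C) * ‖Q (f k)‖ := by
    intro s hs n k
    obtain ⟨c, hcI, -, hl⟩ := riemannIntegrand_apply f Φ (K n) n hs
    have h0 := hb s (Ioc_subset_Icc_self hs) k
    rw [sub_apply, hl, add_mul]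
    refine (norm_sub_le _ _).trans (add_le_add ?_ h0)
    split_ifs
    · exact hb c hcI k
    · rw [norm_zero]
      exact (norm_nonneg _).trans h0
  refine ⟨φ, ?_⟩
  have hlim : ∀ s ∈ Ioc (0 : ℝ) t,
      Tendsto (fun n => hsNormSq f ((φ n).toFun f s - Φ s)) atTop (𝓝 0) := by
    intro s hs
    choose c hcI hcs hl using fun n => riemannIntegrand_apply f Φ (K n) n hs
    have hz : Tendsto (fun n : ℕ => (t : ℝ) / ((n : ℝ) + 1)) atTop (𝓝 0) := by
      simpa [Function.comp_def] using
        (tendsto_const_div_atTop_nhds_zero_nat (t : ℝ)).comp (tendsto_add_atTop_nat 1)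
    have hclim : Tendsto c atTop (𝓝[Icc (0 : ℝ) t] s) := by
      refine tendsto_nhdsWithin_iff.2 ⟨?_, Eventually.of_forall hcI⟩
      rw [tendsto_iff_dist_tendsto_zero]
      exact squeeze_zero (fun _ => dist_nonneg) hcs hz
    refine tendsto_hsNormSq_sub hQ (Eventually.of_forall fun n k => hbound s hs n k) fun k => ?_
    refine ((hc k s (Ioc_subset_Icc_self hs)).tendsto.comp hclim).congr' ?_
    filter_upwards [hK k] with n hn
    simp only [φ, hl, if_pos hn, Function.comp]
  have h := tendsto_lintegral_of_dominated_convergence' (μ := volume.restrict (Ioc (0 : ℝ) t))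
    (F := fun n s => hsNormSq f ((φ n).toFun f s - Φ s)) (f := fun _ => 0)
    (fun _ => ENNReal.ofReal (C + C) ^ 2 * hsNormSq f Q) (fun n => ?_)
    (fun n => (ae_restrict_iff' measurableSet_Ioc).2 (ae_of_all _ fun s hs =>
      hsNormSq_le_of_norm_le f (hbound s hs n)))
    (by
      rw [lintegral_const, Measure.restrict_apply_univ, Real.volume_Ioc]
      finiteness)
    ((ae_restrict_iff' measurableSet_Ioc).2 (ae_of_all _ hlim))
  · simpa using h
  · exact (φ n).aemeasurable_hsNormSq_sub f hm

end Riemann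

section Existence

variable {ι U H Ω : Type*} [NormedAddCommGroup U] [InnerProductSpace ℝ U]
  [NormedAddCommGroup H] [InnerProductSpace ℝ H]
  {mΩ : MeasurableSpace Ω} {P : Measure Ω} [IsProbabilityMeasure P]
  {ℱ : Filtration ℝ≥0 mΩ} {B : ι → ℝ≥0 → Ω → ℝ} {t : ℝ≥0}

/-- By the Itô isometry, the integrals of a convergent sequence of elementary integrands converge
in `L²(Ω; H)`. -/
lemma IsCylindricalWiener.exists_tendsto_integral [CompleteSpace H]
    (hB : IsCylindricalWiener P ℱ B) {f : HilbertBasis ι ℝ U} {Φ : ℝ → U →L[ℝ] H}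
    {φ : ℕ → ElemIntegrand ι H t}
    (hm : AEStronglyMeasurable Φ (volume.restrict (Ioc (0 : ℝ) t))) [Countable ι]
    (hφ : Tendsto (fun n => ∫⁻ s in Ioc (0 : ℝ) t, hsNormSq f ((φ n).toFun f s - Φ s))
      atTop (𝓝 0)) :
    ∃ I : Ω → H, MemLp I 2 P ∧
      Tendsto (fun n => eLpNorm (fun ω => (φ n).integral B ω - I ω) 2 P) atTop (𝓝 0) := by
  let X : ℕ → Lp H 2 P := fun n => (hB.memLp_integral (φ n)).toLp _
  have hX : ∀ n m, edist (X n) (X m) ^ 2 ≤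
      2 * ((∫⁻ s in Ioc (0 : ℝ) t, hsNormSq f ((φ n).toFun f s - Φ s)) +
        ∫⁻ s in Ioc (0 : ℝ) t, hsNormSq f ((φ m).toFun f s - Φ s)) := by
    intro n m
    have h1 : (φ n).integral B - (φ m).integral B = ((φ n).sub (φ m)).integral B := by
      ext ω
      exact ((φ n).integral_sub (φ m) B ω).symm
    rw [Lp.edist_toLp_toLp, h1, hB.eLpNorm_integral f,
      ← lintegral_add_left' ((φ n).aemeasurable_hsNormSq_sub f hm),
      ← lintegral_const_mul' _ _ (by simp)]
    refine lintegral_mono fun s => ?_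
    simp only
    rw [hsNormSq_sub_comm f ((φ m).toFun f s), (φ n).toFun_sub,
      ← sub_add_sub_cancel _ (Φ s)]
    exact hsNormSq_add_le f _ _
  have hcauchy : CauchySeq X := by
    rw [EMetric.cauchySeq_iff]
    intro ε hε
    have hδ : 0 < ε ^ 2 / 4 := ENNReal.div_pos (pow_ne_zero _ hε.ne') (by simp)
    obtain ⟨N, hN⟩ := eventually_atTop.1 (hφ.eventually (gt_mem_nhds hδ))
    refine ⟨N, fun m hm n hn => ?_⟩
    refine lt_of_not_ge fun h => (lt_irrefl (ε ^ 2)) (lt_of_le_of_lt (pow_le_pow_left' h 2) ?_)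
    calc edist (X m) (X n) ^ 2 ≤ _ := hX m n
      _ < 2 * (ε ^ 2 / 4 + ε ^ 2 / 4) :=
        (ENNReal.mul_lt_mul_iff_right (by simp) (by simp)).2
          (ENNReal.add_lt_add (hN m hm) (hN n hn))
      _ = ε ^ 2 := by
        rw [← two_mul, ← mul_assoc, ← mul_div_assoc]
        norm_num
        rw [mul_comm, ENNReal.mul_div_cancel_right (by simp) (by simp)]
  obtain ⟨Y, hY⟩ := cauchySeq_tendsto_of_complete hcauchy
  refine ⟨Y, Lp.memLp Y, ?_⟩
  rw [tendsto_iff_edist_tendsto_0] at hY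
  refine hY.congr fun n => ?_
  rw [Lp.edist_def]
  refine eLpNorm_congr_ae ?_
  filter_upwards [(hB.memLp_integral (φ n)).coeFn_toLp] with ω hω
  simp only [Pi.sub_apply]
  rw [hω]

variable {S : ℝ → H →L[ℝ] H}

lemma IsC0Semigroup.continuousOn_convolution [CompleteSpace U] [CompleteSpace H]
    (hS : IsC0Semigroup S) {f : HilbertBasis ι ℝ U} {Q : U →L[ℝ] H} (hQ : hsNormSq f Q < ∞)
    (t : ℝ) : ContinuousOn (fun s => S (t - s) ∘L Q) (Icc 0 t) :=
  (hS.continuousOn_comp hQ).comp (continuousOn_const.sub continuousOn_id)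
    fun _ hs => sub_nonneg.2 hs.2

lemma IsC0Semigroup.exists_isStochasticIntegral [CompleteSpace U] [CompleteSpace H] [Countable ι]
    (hS : IsC0Semigroup S) (hB : IsCylindricalWiener P ℱ B)
    {f : HilbertBasis ι ℝ U} {Q : U →L[ℝ] H} (hQ : hsNormSq f Q < ∞) (t : ℝ≥0) :
    ∃ I : Ω → H, IsStochasticIntegral P f B t (fun s => S (t - s) ∘L Q) I := by
  have hcont := hS.continuousOn_convolution hQ t
  have hm : AEStronglyMeasurable (fun s => S (t - s) ∘L Q) (volume.restrict (Ioc (0 : ℝ) t)) :=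
    (hcont.mono Ioc_subset_Icc_self).aestronglyMeasurable measurableSet_Ioc
  obtain ⟨M, -, hM⟩ := hS.exists_norm_le t
  obtain ⟨φ, hφ⟩ := exists_tendsto_elemIntegrand hQ hm
    (fun s hs k => (S (t - s)).le_of_opNorm_le
      (hM _ ⟨sub_nonneg.2 hs.2, sub_le_self _ hs.1⟩) (Q (f k)))
    fun k => hcont.clm_apply continuousOn_const
  obtain ⟨I, hI, hlim⟩ := hB.exists_tendsto_integral hm hφ
  exact ⟨I, hm, hI, φ, hφ, hlim⟩

end Existence

/-! ### Positivity and trace class -/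

section TraceClass

variable {ι κ U H K : Type*} [NormedAddCommGroup U] [InnerProductSpace ℝ U] [CompleteSpace U]
  [NormedAddCommGroup H] [InnerProductSpace ℝ H] [CompleteSpace H]
  [NormedAddCommGroup K] [InnerProductSpace ℝ K] [CompleteSpace K]

/-- If `W` is a Hilbert–Schmidt operator into a Hilbert space `K` with Hilbert basis `g`, then
`W* W x = ∑ n, ⟪W* g n, x⟫ W* g n` is a nuclear representation of `W* W`. -/
lemma isTraceClass_adjoint_comp (e : HilbertBasis κ ℝ H) (W : H →L[ℝ] K)
    (hW : hsNormSq e W < ∞) : IsTraceClass (ContinuousLinearMap.adjoint W ∘L W) := by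
  obtain ⟨w, g, -⟩ := exists_hilbertBasis ℝ K
  let a : w → H := fun n => ContinuousLinearMap.adjoint W (g n)
  have hsum : Summable fun n => ‖a n‖ ^ 2 := by
    refine summable_of_hsNormSq_lt_top (f := g) (L := ContinuousLinearMap.adjoint W) ?_
    rwa [hsNormSq_adjoint e g W]
  have hx : ∀ x, HasSum (fun n => inner ℝ (a n) x • a n)
      ((ContinuousLinearMap.adjoint W ∘L W) x) := fun x => by
    have h := (g.hasSum_repr (W x)).mapL (ContinuousLinearMap.adjoint W)
    simpa [a, g.repr_apply_apply, ContinuousLinearMap.adjoint_inner_left] using h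
  -- The basis of `K` need not be countable, but only countably many `a n` are nonzero.
  have : Countable (Function.support fun n => ‖a n‖ ^ 2) := hsum.countable_support
  have hzero : ∀ n ∉ Function.support (fun n => ‖a n‖ ^ 2), a n = 0 := fun n hn => by
    simpa using hn
  obtain ⟨j, hj⟩ := exists_injective_nat (Function.support fun n => ‖a n‖ ^ 2)
  let b : ℕ → H := Function.extend j (fun n => a n) 0
  have hb : ∀ n, b (j n) = a n := fun n => hj.extend_apply _ _ n
  have hb0 : ∀ i ∉ range j, b i = 0 := fun i hi =>
    Function.extend_apply' _ _ _ fun ⟨n, hn⟩ => hi ⟨n, hn⟩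
  refine ⟨b, b, ?_, fun x => ?_⟩
  · rw [← hj.summable_iff fun i hi => by rw [hb0 i hi, norm_zero, zero_mul]]
    refine (hsum.subtype (Function.support fun n => ‖a n‖ ^ 2)).congr fun n => ?_
    simp only [Function.comp_apply, hb, sq]
  · rw [← hj.hasSum_iff fun i hi => by rw [hb0 i hi, smul_zero]]
    simp only [Function.comp_def, hb]
    refine (hasSum_subtype_iff_of_support_subset (f := fun n => inner ℝ (a n) x • a n)
      fun n hn => ?_).2 (hx x)
    by_contra h
    exact hn (by simp [hzero n h])

variable {S : ℝ → H →L[ℝ] H} {f : HilbertBasis ι ℝ U} {Q : U →L[ℝ] H} {t : ℝ}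

lemma IsC0Semigroup.inner_integral_covIntegrand (hS : IsC0Semigroup S) (hQ : hsNormSq f Q < ∞)
    (ht : 0 ≤ t) (x y : H) :
    inner ℝ ((∫ s in (0 : ℝ)..t, covIntegrand S Q s) x) y = ∫ s in (0 : ℝ)..t,
      inner ℝ (ContinuousLinearMap.adjoint (S s ∘L Q) x)
        (ContinuousLinearMap.adjoint (S s ∘L Q) y) := by
  have h := ((innerSL ℝ y) ∘L (ContinuousLinearMap.apply ℝ H x)).intervalIntegral_comp_comm
    (hS.intervalIntegrable_covIntegrand hQ ht)
  simp only [ContinuousLinearMap.comp_apply, ContinuousLinearMap.apply_apply,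
    innerSL_apply_apply] at h
  rw [real_inner_comm, ← h]
  congr 1
  ext s
  rw [covIntegrand_eq, ContinuousLinearMap.comp_apply, real_inner_comm,
    ContinuousLinearMap.adjoint_inner_right]

lemma IsC0Semigroup.isPositive_integral_covIntegrand (hS : IsC0Semigroup S)
    (hQ : hsNormSq f Q < ∞) (ht : 0 ≤ t) :
    (∫ s in (0 : ℝ)..t, covIntegrand S Q s).IsPositive := by
  refine (ContinuousLinearMap.isPositive_iff _).2 ⟨fun x y => ?_, fun x => ?_⟩
  · have h1 := hS.inner_integral_covIntegrand hQ ht x y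
    have h2 := hS.inner_integral_covIntegrand hQ ht y x
    simp only [ContinuousLinearMap.coe_coe]
    rw [h1, real_inner_comm, h2]
    simp only [real_inner_comm]
  · rw [hS.inner_integral_covIntegrand hQ ht]
    exact intervalIntegral.integral_nonneg ht fun s _ => real_inner_self_nonneg

/-- `γ = ∫_0^t S(s) Q Q* S(s)* ds` factors as `W* W` through `L²([0, t]; U)`, where
`(W x)(s) = (S(s) Q)* x` is Hilbert–Schmidt. -/
lemma IsC0Semigroup.isTraceClass_integral_covIntegrand (hS : IsC0Semigroup S)
    (hQ : hsNormSq f Q < ∞) (ht : 0 ≤ t) :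
    IsTraceClass (∫ s in (0 : ℝ)..t, covIntegrand S Q s) := by
  set γ := ∫ s in (0 : ℝ)..t, covIntegrand S Q s with hγ
  let Ψ : ℝ → H →L[ℝ] U := fun s => ContinuousLinearMap.adjoint (S s ∘L Q)
  have hΨ : ContinuousOn Ψ (Icc 0 t) :=
    (ContinuousLinearMap.adjoint.continuous.comp_continuousOn (hS.continuousOn_comp hQ)).mono
      Icc_subset_Ici_self
  have hmem : ∀ x, MemLp (fun s => Ψ s x) 2 (volume.restrict (Ioc 0 t)) := fun x => by
    have hc : ContinuousOn (fun s => Ψ s x) (Icc 0 t) := hΨ.clm_apply continuousOn_const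
    obtain ⟨C, hC⟩ := isCompact_Icc.exists_bound_of_continuousOn hc
    exact MemLp.of_bound
      ((hc.mono Ioc_subset_Icc_self).aestronglyMeasurable measurableSet_Ioc) C
      ((ae_restrict_iff' measurableSet_Ioc).2
        (ae_of_all _ fun s hs => hC s (Ioc_subset_Icc_self hs)))
  let W₀ : H →ₗ[ℝ] Lp U 2 (volume.restrict (Ioc 0 t)) :=
    { toFun := fun x => (hmem x).toLp _
      map_add' := fun x y => by
        rw [← MemLp.toLp_add]
        exact MemLp.toLp_congr _ _ (ae_of_all _ fun s => by simp)
      map_smul' := fun c x => by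
        rw [RingHom.id_apply, ← MemLp.toLp_const_smul]
        exact MemLp.toLp_congr _ _ (ae_of_all _ fun s => by simp) }
  have hinner : ∀ x y, inner ℝ (W₀ x) (W₀ y) = inner ℝ (γ x) y := fun x y => by
    rw [hγ, hS.inner_integral_covIntegrand hQ ht, intervalIntegral.integral_of_le ht, L2.inner_def]
    refine integral_congr_ae ?_
    filter_upwards [(hmem x).coeFn_toLp, (hmem y).coeFn_toLp] with s h1 h2
    rw [show (W₀ x) s = Ψ s x from h1, show (W₀ y) s = Ψ s y from h2]
  let W : H →L[ℝ] Lp U 2 (volume.restrict (Ioc 0 t)) := W₀.mkContinuous (√‖γ‖) fun x => by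
    refine le_of_sq_le_sq ?_ (by positivity)
    rw [mul_pow, Real.sq_sqrt (norm_nonneg _), ← real_inner_self_eq_norm_sq, hinner]
    refine (real_inner_le_norm _ _).trans ?_
    rw [sq, ← mul_assoc]
    gcongr
    exact γ.le_opNorm x
  have hγW : γ = ContinuousLinearMap.adjoint W ∘L W := by
    ext x
    refine ext_inner_right ℝ fun y => ?_
    rw [ContinuousLinearMap.comp_apply, ContinuousLinearMap.adjoint_inner_left]
    exact (hinner x y).symm
  obtain ⟨w, e, -⟩ := exists_hilbertBasis ℝ H
  rw [hγW]
  refine isTraceClass_adjoint_comp e W ?_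
  obtain ⟨M, hM0, hM⟩ := hS.exists_norm_le t
  have hWe : ∀ x, ‖W x‖ₑ ^ 2 = ∫⁻ s in Ioc 0 t, ‖Ψ s x‖ₑ ^ 2 := fun x => by
    have h1 : ‖W x‖ₑ = eLpNorm (fun s => Ψ s x) 2 (volume.restrict (Ioc 0 t)) :=
      Lp.enorm_toLp (hmem x)
    have h2 := eLpNorm_nnreal_pow_eq_lintegral (f := fun s => Ψ s x)
      (μ := volume.restrict (Ioc 0 t)) (p := 2) (by norm_num)
    rw [h1]
    simpa using h2
  calc hsNormSq e W ≤ ∫⁻ s in Ioc 0 t, ENNReal.ofReal M ^ 2 * hsNormSq f Q := by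
        rw [hsNormSq, ENNReal.tsum_eq_iSup_sum]
        refine iSup_le fun F => ?_
        simp only [hWe]
        rw [← lintegral_finsetSum' _ fun j _ => ((hmem (e j)).1.enorm).pow_const 2]
        refine setLIntegral_mono' measurableSet_Ioc fun s hs => ?_
        calc ∑ j ∈ F, ‖Ψ s (e j)‖ₑ ^ 2 ≤ hsNormSq e (Ψ s) := ENNReal.sum_le_tsum F
          _ = hsNormSq f (S s ∘L Q) := hsNormSq_adjoint f e _
          _ ≤ _ := hsNormSq_le_of_norm_le f fun k =>
            (S s).le_of_opNorm_le (hM s (Ioc_subset_Icc_self hs)) (Q (f k))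
    _ < ∞ := by
        rw [lintegral_const, Measure.restrict_apply_univ, Real.volume_Ioc]
        exact ENNReal.mul_lt_top (ENNReal.mul_lt_top (by finiteness) hQ) ENNReal.ofReal_lt_top

end TraceClass

/-! ### A group and a semigroup with the same generator -/

section Generator

variable {H : Type*} [NormedAddCommGroup H] [InnerProductSpace ℝ H]
  {A : H →ₗ.[ℝ] H} {S T : ℝ → H →L[ℝ] H}

lemma IsC0Group.tendsto_apply [CompleteSpace H] (hT : IsC0Group T)
    {α : Type*} {l : Filter α} {a : α → ℝ} {a₀ : ℝ}
    {z : α → H} {z₀ : H} (ha : Tendsto a l (𝓝 a₀)) (hz : Tendsto z l (𝓝 z₀)) :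
    Tendsto (fun i => T (a i) (z i)) l (𝓝 (T a₀ z₀)) := by
  obtain ⟨M, hM⟩ := banach_steinhaus (g := fun s : Icc (a₀ - 1) (a₀ + 1) => T s) fun x => by
    obtain ⟨C, hC⟩ := isCompact_Icc.exists_bound_of_continuousOn (hT.continuous x).continuousOn
    exact ⟨C, fun i => hC i i.2⟩
  have h1 : Tendsto (fun i => T (a i) (z i - z₀)) l (𝓝 0) := by
    have hz' : Tendsto (fun i => M * ‖z i - z₀‖) l (𝓝 0) := by
      simpa using ((hz.sub_const z₀).norm).const_mul M
    refine squeeze_zero_norm' ?_ hz'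
    filter_upwards [ha.eventually (Icc_mem_nhds (sub_one_lt a₀) (lt_add_one a₀))] with i hi
    exact (T (a i)).le_of_opNorm_le (hM ⟨a i, hi⟩) _
  simpa using h1.add (((hT.continuous z₀).tendsto a₀).comp ha)

/-- The domain of the generator is invariant under the semigroup, and `A` commutes with `S s`. -/
lemma IsC0Semigroup.mem_graph_apply (hS : IsC0Semigroup S) (hA : IsGenerator A S) {x y : H}
    (hxy : (x, y) ∈ A.graph) {s : ℝ} (hs : 0 ≤ s) : (S s x, S s y) ∈ A.graph := by
  rw [hA] at hxy ⊢
  refine (((S s).continuous.tendsto y).comp hxy).congr' ?_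
  filter_upwards [self_mem_nhdsWithin] with h hh
  have h1 : S h (S s x) = S s (S h x) := by
    rw [← ContinuousLinearMap.comp_apply, ← ContinuousLinearMap.comp_apply,
      ← hS.map_add _ _ (le_of_lt hh) hs, ← hS.map_add _ _ hs (le_of_lt hh), add_comm]
  simp [h1]

/-- For `x ∈ D(A)` the curve `s ↦ T(-s) S(s) x` has vanishing right derivative. -/
lemma IsC0Group.apply_eq_of_mem_graph [CompleteSpace H] (hT : IsC0Group T)
    (hTA : IsGroupGenerator A T)
    (hS : IsC0Semigroup S) (hA : IsGenerator A S) {x y : H} (hxy : (x, y) ∈ A.graph) {r : ℝ}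
    (hr : 0 ≤ r) : T r x = S r x := by
  have hcont : ContinuousOn (fun s => T (-s) (S s x)) (Icc 0 r) := fun s hs =>
    hT.tendsto_apply (continuous_neg.continuousWithinAt)
      ((hS.continuousOn x s hs.1).mono Icc_subset_Ici_self)
  have hderiv : ∀ s ∈ Ico 0 r, HasDerivWithinAt (fun s => T (-s) (S s x)) 0 (Ici s) s := by
    intro s hs
    rw [hasDerivWithinAt_iff_tendsto_slope, Ici_sdiff_left]
    have hz := hS.mem_graph_apply hA hxy hs.1
    have h1 := (hA _ _).1 hz
    have h2 := ((hTA _ _).1 hz).mono_left (nhdsGT_le_nhdsNE 0)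
    have hsub : Tendsto (fun u => u - s) (𝓝[>] s) (𝓝[>] 0) := by
      refine tendsto_nhdsWithin_iff.2 ⟨?_, ?_⟩
      · have : Tendsto (fun u => u - s) (𝓝 s) (𝓝 (s - s)) := tendsto_id.sub_const s
        rw [sub_self] at this
        exact this.mono_left nhdsWithin_le_nhds
      · filter_upwards [self_mem_nhdsWithin] with u hu
        exact sub_pos.2 (mem_Ioi.1 hu)
    -- The increment of the curve from `s` to `u` is `T (-u)` applied to the difference of the
    -- increments of `S` and `T` over a time `u - s` at `S s x`, whose quotients have equal limits.
    have h3 := (h1.sub h2).comp hsub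
    rw [sub_self] at h3
    have h4 := hT.tendsto_apply (a := fun u => -u) (a₀ := -s)
      ((continuous_neg.tendsto s).mono_left nhdsWithin_le_nhds) h3
    rw [_root_.map_zero] at h4
    refine h4.congr' ?_
    filter_upwards [self_mem_nhdsWithin] with u hu
    have h5 : S u x = S (u - s) (S s x) := by
      rw [← ContinuousLinearMap.comp_apply, ← hS.map_add _ _ (sub_nonneg.2 (le_of_lt hu)) hs.1,
        sub_add_cancel]
    have h6 : T (-s) (S s x) = T (-u) (T (u - s) (S s x)) := by
      rw [← ContinuousLinearMap.comp_apply (T (-u)), ← hT.map_add]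
      congr 2
      ring
    simp only [slope_def_module, Function.comp, h5, h6, map_sub, map_smul]
    rw [← smul_sub, sub_sub_sub_cancel_right]
  have h := constant_of_has_deriv_right_zero hcont hderiv r ⟨hr, le_rfl⟩
  simp only [neg_zero, hT.map_zero, hS.map_zero, ContinuousLinearMap.id_apply] at h
  conv_lhs => rw [← h]
  rw [← ContinuousLinearMap.comp_apply, hT.comp_neg, ContinuousLinearMap.id_apply]

/-- The domain of the generator is dense: the averages `h⁻¹ ∫_0^h S(s) x ds` belong to it. -/
lemma IsC0Semigroup.exists_mem_graph_tendsto [CompleteSpace H] (hS : IsC0Semigroup S)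
    (hA : IsGenerator A S)
    (x : H) : ∃ y z : ℝ → H, (∀ h, 0 < h → (y h, z h) ∈ A.graph) ∧
      Tendsto y (𝓝[>] 0) (𝓝 x) := by
  -- `S` is unconstrained at negative times; `g` is a continuous extension of its orbit.
  let g : ℝ → H := fun s => S (max s 0) x
  have hg : Continuous g :=
    (hS.continuousOn x).comp_continuous (continuous_id.max continuous_const)
      fun s => le_max_right s 0
  let G : ℝ → H := fun u => ∫ s in (0 : ℝ)..u, g s
  have hG : ∀ u, HasDerivAt G (g u) u := fun u => (hg.integral_hasStrictDerivAt 0 u).hasDerivAt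
  have hG0 : G 0 = 0 := intervalIntegral.integral_same
  have hlim : ∀ u, Tendsto (fun δ : ℝ => δ⁻¹ • (G (u + δ) - G u)) (𝓝[>] 0) (𝓝 (g u)) := fun u =>
    (hasDerivAt_iff_tendsto_slope_zero.1 (hG u)).mono_left (nhdsGT_le_nhdsNE 0)
  refine ⟨fun h => h⁻¹ • G h, fun h => h⁻¹ • (g h - g 0), fun h hh => ?_, ?_⟩
  · refine (A.graph.smul_mem h⁻¹ (x := (G h, g h - g 0)) ?_)
    rw [hA]
    refine ((hlim h).sub (hlim 0)).congr' ?_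
    filter_upwards [self_mem_nhdsWithin] with δ hδ
    have hδ : 0 < δ := hδ
    have h1 : S δ (G h) = G (h + δ) - G δ := by
      rw [← (S δ).intervalIntegral_comp_comm (hg.intervalIntegrable _ _),
        intervalIntegral.integral_interval_sub_left (hg.intervalIntegrable _ _)
          (hg.intervalIntegrable _ _)]
      have h2 := intervalIntegral.integral_comp_add_right (a := 0) (b := h) g δ
      rw [zero_add] at h2
      rw [← h2]
      refine intervalIntegral.integral_congr fun s hs => ?_
      rw [uIcc_of_le hh.le] at hs
      simp only [g]
      rw [max_eq_left hs.1, max_eq_left (add_nonneg hs.1 hδ.le), add_comm,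
        hS.map_add _ _ hδ.le hs.1, ContinuousLinearMap.comp_apply]
    rw [← smul_sub, h1, hG0, zero_add]
    congr 1
    abel
  · have h := hlim 0
    simpa [hG0, g, hS.map_zero] using h

/-- A `C₀`-group whose generator also generates the semigroup `S` extends `S`. -/
lemma IsC0Group.eq_of_generator [CompleteSpace H] (hT : IsC0Group T) (hTA : IsGroupGenerator A T)
    (hS : IsC0Semigroup S) (hA : IsGenerator A S) {r : ℝ} (hr : 0 ≤ r) : T r = S r := by
  ext x
  obtain ⟨y, z, hyz, hy⟩ := hS.exists_mem_graph_tendsto hA x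
  refine tendsto_nhds_unique (((T r).continuous.tendsto x).comp hy) ?_
  refine (((S r).continuous.tendsto x).comp hy).congr' ?_
  filter_upwards [self_mem_nhdsWithin] with h hh
  exact (hT.apply_eq_of_mem_graph hTA hS hA (hyz h hh) hr).symm

end Generator

/-! ### The Malliavin derivative of the mild solution -/

section Malliavin

variable {ι U H Ω : Type*} [NormedAddCommGroup U] [InnerProductSpace ℝ U]
  [NormedAddCommGroup H] [InnerProductSpace ℝ H]
  {mΩ : MeasurableSpace Ω} {P : Measure Ω} {B : ι → ℝ≥0 → Ω → ℝ} {t : ℝ≥0}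

lemma isStochasticIntegral_increment (f : HilbertBasis ι ℝ U) {a b : ℝ≥0}
    (hab : a ≤ b) (hb : b ≤ t) (k : ι) (hX : MemLp (fun ω => B k b ω - B k a ω) 2 P) :
    IsStochasticIntegral P f B t
      (fun s => innerSL ℝ ((Ioc (a : ℝ) b).indicator (fun _ => f k) s))
      (fun ω => B k b ω - B k a ω) := by
  refine ⟨?_, hX, fun _ => ElemIntegrand.ofFintype (α := Unit) (fun _ => a) (fun _ => b)
    (fun _ => hab) (fun _ => hb) (fun _ => k) (fun _ => 1), ?_, ?_⟩
  · exact ((innerSL ℝ (E := U)).continuous.comp_stronglyMeasurable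
      (stronglyMeasurable_const.indicator measurableSet_Ioc)).aestronglyMeasurable
  · refine tendsto_const_nhds.congr fun n => ?_
    symm
    rw [lintegral_eq_zero_of_ae_eq_zero]
    refine ae_of_all _ fun s => ?_
    simp only [ElemIntegrand.toFun_ofFintype, Pi.zero_apply]
    by_cases hs : s ∈ Ioc (a : ℝ) b
    · simp [hsNormSq, indicator_of_mem hs]
    · simp [hsNormSq, indicator_of_notMem hs]
  · refine tendsto_const_nhds.congr fun n => ?_
    simp [ElemIntegrand.integral_ofFintype]

/-- The functional `c + ∫_0^t φ dW` for an elementary integrand `φ`, as a smooth cylindrical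
functional: the `g_j` are the constant `1` and the coordinate functions. -/
noncomputable def ElemIntegrand.smoothFunctional {ℱ : Filtration ℝ≥0 mΩ}
    (hB : IsCylindricalWiener P ℱ B) (f : HilbertBasis ι ℝ U) (φ : ElemIntegrand ι H t) (c : H) :
    SmoothFunctional H P f B t where
  n := φ.n
  m := φ.n + 1
  h i := (Ioc (φ.a i : ℝ) (φ.b i)).indicator fun _ => f (φ.k i)
  X i ω := B (φ.k i) (φ.b i) ω - B (φ.k i) (φ.a i) ω
  isIntegral i := isStochasticIntegral_increment f (φ.a_le_b i) (φ.b_le i) (φ.k i)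
    (hB.memLp_sub _ _ _)
  g := Fin.cases (fun _ => 1) fun i p => p i
  growth := Fin.cases (Function.HasTemperateGrowth.const 1) fun i =>
    (ContinuousLinearMap.proj (R := ℝ) (φ := fun _ : Fin φ.n => ℝ) i).hasTemperateGrowth
  v := Fin.cases c φ.x

lemma ElemIntegrand.value_smoothFunctional {ℱ : Filtration ℝ≥0 mΩ}
    (hB : IsCylindricalWiener P ℱ B) (f : HilbertBasis ι ℝ U) (φ : ElemIntegrand ι H t) (c : H)
    (ω : Ω) : (φ.smoothFunctional hB f c).value ω = c + φ.integral B ω := by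
  refine (Fin.sum_univ_succ (n := φ.n) _).trans ?_
  simp [smoothFunctional, ElemIntegrand.integral]

lemma ElemIntegrand.deriv_smoothFunctional {ℱ : Filtration ℝ≥0 mΩ}
    (hB : IsCylindricalWiener P ℱ B) (f : HilbertBasis ι ℝ U) (φ : ElemIntegrand ι H t) (c : H)
    (ω : Ω) (s : ℝ) : (φ.smoothFunctional hB f c).deriv ω s = φ.toFun f s := by
  have hproj : ∀ (i l : Fin φ.n) (p : Fin φ.n → ℝ),
      fderiv ℝ (fun p : Fin φ.n → ℝ => p i) p (Pi.single l 1) = if i = l then 1 else 0 := by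
    intro i l p
    have h := (ContinuousLinearMap.proj (R := ℝ) (φ := fun _ : Fin φ.n => ℝ) i).hasFDerivAt (x := p)
    rw [show fderiv ℝ (fun p : Fin φ.n → ℝ => p i) p = _ from h.fderiv,
      ContinuousLinearMap.proj_apply, Pi.single_apply]
  refine (Fin.sum_univ_succ (n := φ.n) _).trans ?_
  change (∑ i, fderiv ℝ (fun _ : Fin φ.n → ℝ => (1 : ℝ))
      (fun l => B (φ.k l) (φ.b l) ω - B (φ.k l) (φ.a l) ω) (Pi.single i 1) •
      (innerSL ℝ ((Ioc (φ.a i : ℝ) (φ.b i)).indicator (fun _ => f (φ.k i)) s)).smulRight c) +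
    ∑ j, ∑ i, fderiv ℝ (fun p : Fin φ.n → ℝ => p j)
      (fun l => B (φ.k l) (φ.b l) ω - B (φ.k l) (φ.a l) ω) (Pi.single i 1) •
      (innerSL ℝ ((Ioc (φ.a i : ℝ) (φ.b i)).indicator (fun _ => f (φ.k i)) s)).smulRight
        (φ.x j) = _
  simp only [hproj, fderiv_fun_const, Pi.zero_apply, zero_apply, zero_smul,
    Finset.sum_const_zero, zero_add, ite_smul, one_smul, Finset.sum_ite_eq, Finset.mem_univ,
    if_true]
  refine Finset.sum_congr rfl fun i _ => ?_
  by_cases hs : s ∈ Ioc (φ.a i : ℝ) (φ.b i)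
  · simp only [indicator_of_mem hs]
  · simp only [indicator_of_notMem hs]
    ext; simp

/-- A constant plus the Itô integral of a deterministic integrand `Φ` belongs to `𝔻^{1,2}`, with
Malliavin derivative `Φ`. -/
lemma IsStochasticIntegral.hasMalliavinDerivative [Countable ι] [IsProbabilityMeasure P]
    {ℱ : Filtration ℝ≥0 mΩ} (hB : IsCylindricalWiener P ℱ B) {f : HilbertBasis ι ℝ U}
    {Φ : ℝ → U →L[ℝ] H} {I F : Ω → H} {c : H} (hI : IsStochasticIntegral P f B t Φ I)
    (hF : F =ᵐ[P] fun ω => c + I ω) :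
    HasMalliavinDerivative P f B t F fun _ => Φ := by
  obtain ⟨hm, hI2, φ, hφ, hφI⟩ := hI
  refine ⟨((memLp_const c).add hI2).ae_eq hF.symm, hm.comp_snd,
    fun n => (φ n).smoothFunctional hB f c, ?_, ?_⟩
  · refine hφI.congr fun n => eLpNorm_congr_ae ?_
    filter_upwards [hF] with ω hω
    rw [ElemIntegrand.value_smoothFunctional, hω, add_sub_add_left_eq_sub]
  · refine hφ.congr fun n => ?_
    simp only [ElemIntegrand.deriv_smoothFunctional]
    have h := lintegral_map' (μ := P.prod (volume.restrict (Ioc (0 : ℝ) t))) (g := Prod.snd)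
      (f := fun s => hsNormSq f ((φ n).toFun f s - Φ s))
      (by
        rw [measurePreserving_snd.map_eq]
        exact (φ n).aemeasurable_hsNormSq_sub f hm) measurable_snd.aemeasurable
    rw [measurePreserving_snd.map_eq] at h
    exact h

end Malliavin

/-! ### The group case and conclusion -/

/-- Since `S (t - r) = T t ∘ T (-r)` for `0 ≤ r ≤ t`, the substitution `s = t - r` takes `S t` out
of the integral. -/
lemma IsC0Group.integral_covIntegrand_eq {U H : Type*}
    [NormedAddCommGroup U] [InnerProductSpace ℝ U] [CompleteSpace U]
    [NormedAddCommGroup H] [InnerProductSpace ℝ H] [CompleteSpace H]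
    {S T : ℝ → H →L[ℝ] H} (hT : IsC0Group T) (hTS : ∀ r : ℝ, 0 ≤ r → T r = S r)
    {Q : U →L[ℝ] H} {t : ℝ}
    (hint : IntervalIntegrable (covIntegrand (fun r => T (-r)) Q) volume 0 t) (ht : 0 ≤ t) :
    (∫ s in (0 : ℝ)..t, covIntegrand S Q s) =
      S t ∘L (∫ r in (0 : ℝ)..t, covIntegrand (fun r => T (-r)) Q r) ∘L
        ContinuousLinearMap.adjoint (S t) := by
  have h2 := intervalIntegral.integral_comp_sub_left (a := 0) (b := t) (covIntegrand S Q) t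
  rw [sub_self, sub_zero] at h2
  have h3 := ((ContinuousLinearMap.compL ℝ H H H (S t)) ∘L
    ((ContinuousLinearMap.compL ℝ H H H).flip
      (ContinuousLinearMap.adjoint (S t)))).intervalIntegral_comp_comm hint
  simp only [ContinuousLinearMap.comp_apply, ContinuousLinearMap.flip_apply,
    ContinuousLinearMap.compL_apply] at h3
  rw [← h2, ← h3]
  refine intervalIntegral.integral_congr fun r hr => ?_
  rw [uIcc_of_le ht] at hr
  have h4 : S (t - r) = S t ∘L T (-r) := by
    rw [← hTS _ (sub_nonneg.2 hr.2), ← hTS t ht, ← hT.map_add, sub_eq_add_neg]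
  simp only [covIntegrand, h4, ContinuousLinearMap.adjoint_comp]
  rfl

theorem theorem1
    {H U Ω ι : Type*}
    [NormedAddCommGroup H] [InnerProductSpace ℝ H] [CompleteSpace H]
    [TopologicalSpace.SeparableSpace H]
    [NormedAddCommGroup U] [InnerProductSpace ℝ U] [CompleteSpace U]
    [TopologicalSpace.SeparableSpace U]
    [Countable ι] (f : HilbertBasis ι ℝ U)
    {mΩ : MeasurableSpace Ω} (P : Measure Ω) [IsProbabilityMeasure P]
    (ℱ : Filtration ℝ≥0 mΩ)
    (B : ι → ℝ≥0 → Ω → ℝ) (hB : IsCylindricalWiener P ℱ B)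
    (A : H →ₗ.[ℝ] H) (S : ℝ → H →L[ℝ] H) (hS : IsC0Semigroup S) (hA : IsGenerator A S)
    (Qhalf : U →L[ℝ] H) (hQ : hsNormSq f Qhalf < ∞)
    (u₀ : H) :
    (∃ u : ℝ≥0 → Ω → H, IsMildSolution P f B S Qhalf u₀ u) ∧
    ∀ u : ℝ≥0 → Ω → H, IsMildSolution P f B S Qhalf u₀ u → ∀ t : ℝ≥0, 0 < t →
      IntervalIntegrable (covIntegrand S Qhalf) volume 0 t ∧
      HasMalliavinCovariance P f B t (u t)
        (fun _ => ∫ s in (0 : ℝ)..t, covIntegrand S Qhalf s) ∧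
      (∫ s in (0 : ℝ)..t, covIntegrand S Qhalf s).IsPositive ∧
      IsSelfAdjoint (∫ s in (0 : ℝ)..t, covIntegrand S Qhalf s) ∧
      IsTraceClass (∫ s in (0 : ℝ)..t, covIntegrand S Qhalf s) ∧
      ∀ T : ℝ → H →L[ℝ] H, IsC0Group T → IsGroupGenerator A T →
        (∀ r : ℝ, 0 ≤ r → T r = S r) ∧
        (∀ r : ℝ, T r ∘L T (-r) = ContinuousLinearMap.id ℝ H ∧
          T (-r) ∘L T r = ContinuousLinearMap.id ℝ H) ∧
        IntervalIntegrable (covIntegrand (fun r => T (-r)) Qhalf) volume 0 t ∧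
        IsTraceClass (∫ r in (0 : ℝ)..t, covIntegrand (fun r => T (-r)) Qhalf r) ∧
        (∫ s in (0 : ℝ)..t, covIntegrand S Qhalf s) =
          S t ∘L (∫ r in (0 : ℝ)..t, covIntegrand (fun r => T (-r)) Qhalf r) ∘L
            ContinuousLinearMap.adjoint (S t) := by
  refine ⟨?_, fun u hu t ht => ?_⟩
  · choose I hI using hS.exists_isStochasticIntegral hB hQ
    exact ⟨fun t ω => S t u₀ + I t ω, fun t => ⟨I t, hI t, EventuallyEq.rfl⟩⟩
  have ht0 : (0 : ℝ) ≤ t := t.2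
  have hint := hS.intervalIntegrable_covIntegrand hQ ht0
  have hpos := hS.isPositive_integral_covIntegrand hQ ht0
  refine ⟨hint, ?_, hpos, hpos.isSelfAdjoint, hS.isTraceClass_integral_covIntegrand hQ ht0,
    fun T hT hTA => ?_⟩
  · obtain ⟨I, hI, huI⟩ := hu t
    refine ⟨_, hI.hasMalliavinDerivative hB huI, ae_of_all _ fun ω => ?_⟩
    simp only [← covIntegrand_eq]
    have h1 : IntervalIntegrable (fun r => covIntegrand S Qhalf (t - r)) volume 0 t := by
      simpa using (hint.comp_sub_left t).symm
    have h2 := intervalIntegral.integral_comp_sub_left (a := 0) (b := t) (covIntegrand S Qhalf) t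
    rw [sub_self, sub_zero] at h2
    exact ⟨h1, h2.symm⟩
  · have hTS : ∀ r : ℝ, 0 ≤ r → T r = S r := fun r hr => hT.eq_of_generator hTA hS hA hr
    have hT' := hT.neg.isC0Semigroup
    have hint' := hT'.intervalIntegrable_covIntegrand hQ ht0
    refine ⟨hTS, fun r => ⟨hT.comp_neg r, by simpa using hT.comp_neg (-r)⟩, hint',
      hT'.isTraceClass_integral_covIntegrand hQ ht0, ?_⟩
    exact hT.integral_covIntegrand_eq hTS hint' ht0
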